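/- Let $\{\psi_j\}_{j\ge 1}$ be an orthonormal basis of the real Hilbert space $L^2[0,1]$. For a strictly positive sequence $w=(w_j)_{j\ge1}$ put $\|f\|_w^2:=\sum_{j\ge1} w_j\langle f,\psi_j\rangle^2\in[0,\infty]$, and let $\mathcal W_w:=\{f\in L^2[0,1]:\|f\|_w<\infty\}$. For $m\ge 1$, a function $f$ and an operator $K$, let $[f]_m:=(\langle f,\psi_i\rangle)_{1\le i\le m}$ and $[K]_m:=(\langle K\psi_j,\psi_i\rangle)_{1\le i,j\le m}$; $\|\cdot\|$ denotes the spectral norm of a matrix. **Weights.** Let $\omega,b,\upsilon$ be strictly positive sequences with $\omega_1=b_1=\upsilon_1=1$ such that $b$ and $(b_j/\omega_j)_j$ are non-decreasing, $\upsilon$ and $(\upsilon_j^2/\omega_j)_j$ are non-increasing, and $\sum_j\upsilon_j<\infty$. **Model.** Let $Y=\langle\beta,X\rangle+\sigma\epsilon$ almost surely, with $\sigma>0$, $\beta\in\mathcal W_b$ and $E[\epsilon X]=0$. Let $\eta\ge1$. The random function $X$ with values in $L^2[0,1]$ is centred, with $E\|X\|^2<\infty$, and its covariance operator $\Gamma f=E[\langle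 X,f\rangle X]$ is strictly positive. It satisfies $E\bigl|[X]_j/[\Gamma]_{j,j}^{1/2}\bigr|^4\le\eta$ for all $j\ge1$ and $E\bigl|([\Gamma]_m^{-1/2}[X]_m)_j\bigr|^4\le\eta$ for all $1\le j\le m$, $m\ge1$. The error $\epsilon$ is a real random variable with $E\epsilon=0$, $E\epsilon^2=1$ and $E\epsilon^4\le\eta$. **Link condition.** Let $d\ge1$, and let $\Gamma\in\mathcal N_\upsilon^d$, that is, $\Gamma$ is a self-adjoint nuclear operator with $d^{-2}\|f\|_{\upsilon^2}^2\le\|\Gamma f\|^2\le d^2\|f\|_{\upsilon^2}^2$ for all $f\in L^2[0,1]$. **Estimator.** For each $n$, let $(Y_1,X_1),\dots,(Y_n,X_n)$ be independent copies of $(Y,X)$. Put $\widehat g=\frac1n\sum_{i=1}^n Y_iX_i$ and $\widehat\Gamma=\frac1n\sum_{i=1}^n\langle X_i,\cdot\rangle X_i$. For a dimension $m=m(n)$ and the threshold $\gamma=8d^3/\upsilon_m$, let $$\widehat\beta=\sum_{l=1}^m\bigl([\widehat\Gamma]_m^{-1}[\widehat g]_m\bigr)_l\,\psi_l$$ if $[\widehat\Gamma]_m$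 is nonsingular with $\|[\widehat\Gamma]_m^{-1}\|\le\gamma$, and $\widehat\beta=0$ otherwise. **Claim.** Suppose that, as $n\to\infty$, $$m\to\infty,\qquad \frac mn\sup_{1\le j\le m}\frac{\omega_j}{\upsilon_j}\to0,\qquad \frac{m^2}{n}\to0,\qquad \frac{m^3}{\upsilon_m^2\,n^{3/2}}=O(1).$$ Then $E\|\widehat\beta-\beta\|_\omega^2\to0$ as $n\to\infty$. -/

import Mathlib

open MeasureTheory ProbabilityTheory Filter Topology Asymptotics
open scoped ENNReal RealInnerProductSpace

/-- The real Hilbert space `L²[0,1]`. -/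
abbrev L2I : Type := Lp ℝ 2 (volume.restrict (Set.Icc (0 : ℝ) 1))

/-- `L²[0,1]` carries its Borel sigma-algebra. -/
noncomputable instance L2I.instMeasurableSpace : MeasurableSpace L2I := borel L2I

instance L2I.instBorelSpace : BorelSpace L2I := ⟨rfl⟩

namespace FunLinReg

/-! All sequences `ψ₁, ψ₂, …`, `ω₁, ω₂, …` are indexed from `0` in the code: `ψ j` stands for
`ψ_{j+1}`, and so on.  Hence `ψ_1, …, ψ_m` are the `ψ j` with `j : Fin m`, and `υ_m` is
`υ (m - 1)`. -/

/-- The squared weighted norm `‖f‖_w² = ∑_j w_j ⟨f, ψ_j⟩²`, with values in `[0, ∞]`. -/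
noncomputable def weightedNormSq (ψ : HilbertBasis ℕ ℝ L2I) (w : ℕ → ℝ) (f : L2I) : ℝ≥0∞ :=
  ∑' j, ENNReal.ofReal (w j * ⟪ψ j, f⟫ ^ 2)

/-- The ellipsoid `W_b^ρ = {f : ‖f‖_b² ≤ ρ}`. -/
def ellipsoid (ψ : HilbertBasis ℕ ℝ L2I) (b : ℕ → ℝ) (ρ : ℝ) : Set L2I :=
  {f | weightedNormSq ψ b f ≤ ENNReal.ofReal ρ}

/-- The class `W_b`: the union of the ellipsoids `W_b^ρ`, `ρ > 0`. -/
def sobolevClass (ψ : HilbertBasis ℕ ℝ L2I) (b : ℕ → ℝ) : Set L2I :=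
  ⋃ ρ ∈ Set.Ioi (0 : ℝ), ellipsoid ψ b ρ

/-- The vector `[f]_m` of the first `m` coefficients of `f`. -/
noncomputable def coeffVec (ψ : HilbertBasis ℕ ℝ L2I) (m : ℕ) (f : L2I) : Fin m → ℝ :=
  fun i => ⟪ψ i, f⟫

/-- The matrix `[K]_m` with entries `⟨K ψ_j, ψ_i⟩`, `1 ≤ i, j ≤ m`. -/
noncomputable def opMatrix (ψ : HilbertBasis ℕ ℝ L2I) (m : ℕ) (K : L2I →L[ℝ] L2I) :
    Matrix (Fin m) (Fin m) ℝ :=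
  Matrix.of fun i j => ⟪ψ i, K (ψ j)⟫

/-- The inverse square root `A^{-1/2}` of a symmetric positive definite matrix, by functional
calculus. -/
noncomputable def invSqrt {m : ℕ} (A : Matrix (Fin m) (Fin m) ℝ) : Matrix (Fin m) (Fin m) ℝ :=
  cfc (fun x : ℝ => (√x)⁻¹) A

/-- The spectral norm of a matrix: its operator norm for the Euclidean norm. -/
noncomputable def specNorm {m : ℕ} (A : Matrix (Fin m) (Fin m) ℝ) : ℝ :=
  ‖Matrix.toEuclideanCLM (n := Fin m) (𝕜 := ℝ) A‖

/-- Nuclear operators on `L²[0,1]`. -/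
def IsNuclear (T : L2I →L[ℝ] L2I) : Prop :=
  ∃ a c : ℕ → L2I, Summable (fun k => ‖a k‖ * ‖c k‖) ∧
    ∀ f, HasSum (fun k => ⟪a k, f⟫ • c k) (T f)

/-- The link condition: the class `N_υ^d` of self-adjoint nuclear operators `Γ` with
`‖f‖²_{υ²} / d² ≤ ‖Γ f‖² ≤ d² ‖f‖²_{υ²}` for all `f`. -/
structure LinkClass (ψ : HilbertBasis ℕ ℝ L2I) (υ : ℕ → ℝ) (d : ℝ) (Γ : L2I →L[ℝ] L2I) :
    Prop where
  selfAdjoint : IsSelfAdjoint Γ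
  nuclear : IsNuclear Γ
  lower : ∀ f, weightedNormSq ψ (fun j => υ j ^ 2) f / ENNReal.ofReal (d ^ 2)
    ≤ ENNReal.ofReal (‖Γ f‖ ^ 2)
  upper : ∀ f, ENNReal.ofReal (‖Γ f‖ ^ 2)
    ≤ ENNReal.ofReal (d ^ 2) * weightedNormSq ψ (fun j => υ j ^ 2) f

/-- The basic regularity assumption on the three weight sequences. -/
structure RegularWeights (ω b υ : ℕ → ℝ) : Prop where
  omega_pos : ∀ j, 0 < ω j
  b_pos : ∀ j, 0 < b j
  upsilon_pos : ∀ j, 0 < υ j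
  omega_one : ω 0 = 1
  b_one : b 0 = 1
  upsilon_one : υ 0 = 1
  b_mono : Monotone b
  b_div_omega_mono : Monotone fun j => b j / ω j
  upsilon_anti : Antitone υ
  upsilon_sq_div_omega_anti : Antitone fun j => υ j ^ 2 / ω j
  upsilon_summable : Summable υ

section Model

variable {Ω : Type*} [MeasurableSpace Ω]

/-- The covariance operator `Γ f = E[⟨X, f⟩ X]` of a centred random function `X` with finite
second moment. -/
noncomputable def covOp (X : Ω → L2I) (P : Measure Ω) : L2I →L[ℝ] L2I :=
  covarianceOperator (P.map X)

/-- The class `𝒳_η^k` of centred random functions with finite second moment, strictly positive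
covariance operator `Γ`, and `k`-th absolute moments of all `[X]_j / Γ_{jj}^{1/2}` and all
`(Γ_m^{-1/2} [X]_m)_j`, `1 ≤ j ≤ m`, bounded by `η`. -/
structure RegressorClass (ψ : HilbertBasis ℕ ℝ L2I) (k : ℕ) (η : ℝ) (X : Ω → L2I)
    (P : Measure Ω) : Prop where
  memLp : MemLp X 2 P
  centred : ∫ w, X w ∂P = 0
  strictPos : ∀ f : L2I, f ≠ 0 → 0 < ⟪covOp X P f, f⟫
  coord_moment : ∀ j : ℕ,
    Integrable (fun w => |⟪ψ j, X w⟫ / √⟪ψ j, covOp X P (ψ j)⟫| ^ k) P ∧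
      ∫ w, |⟪ψ j, X w⟫ / √⟪ψ j, covOp X P (ψ j)⟫| ^ k ∂P ≤ η
  standardized_moment : ∀ (m : ℕ) (j : Fin m),
    Integrable
        (fun w => |(invSqrt (opMatrix ψ m (covOp X P))).mulVec (coeffVec ψ m (X w)) j| ^ k) P ∧
      ∫ w, |(invSqrt (opMatrix ψ m (covOp X P))).mulVec (coeffVec ψ m (X w)) j| ^ k ∂P ≤ η

/-- The class `ℰ_η^k` of centred error terms with variance one and `k`-th absolute moment at
most `η`. -/
structure ErrorClass (k : ℕ) (η : ℝ) (ε : Ω → ℝ) (P : Measure Ω) : Prop where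
  memLp : MemLp ε 2 P
  centred : ∫ w, ε w ∂P = 0
  variance_one : ∫ w, ε w ^ 2 ∂P = 1
  moment_integrable : Integrable (fun w => |ε w| ^ k) P
  moment_le : ∫ w, |ε w| ^ k ∂P ≤ η

/-- The functional linear model `Y = ⟨β, X⟩ + σ ε` almost surely, with `E[ε X] = 0`. -/
structure LinearModel (β : L2I) (σ : ℝ) (X : Ω → L2I) (ε Y : Ω → ℝ) (P : Measure Ω) : Prop where
  model : ∀ᵐ w ∂P, Y w = ⟪β, X w⟫ + σ * ε w
  uncorrelated : ∫ w, ε w • X w ∂P = 0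

/-- `(Ys i, Xs i)`, `i < n`, is an `n`-sample of `(Y, X)`: independent copies of `(Y, X)`, on a
probability space of their own. -/
structure IsSample {Ω' : Type*} [MeasurableSpace Ω'] {n : ℕ} (Ys : Fin n → Ω' → ℝ)
    (Xs : Fin n → Ω' → L2I) (P' : Measure Ω') (Y : Ω → ℝ) (X : Ω → L2I) (P : Measure Ω) :
    Prop where
  indep : iIndepFun (fun i w => (Ys i w, Xs i w)) P'
  identDistrib : ∀ i, IdentDistrib (fun w => (Ys i w, Xs i w)) (fun w => (Y w, X w)) P' P

end Model

/-- `ĝ = (1/n) ∑ Y_i X_i`. -/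
noncomputable def empCross {n : ℕ} (y : Fin n → ℝ) (x : Fin n → L2I) : L2I :=
  (n : ℝ)⁻¹ • ∑ i, y i • x i

/-- `Γ̂ = (1/n) ∑ ⟨X_i, ·⟩ X_i`. -/
noncomputable def empCov {n : ℕ} (x : Fin n → L2I) : L2I →L[ℝ] L2I :=
  (n : ℝ)⁻¹ • ∑ i, InnerProductSpace.rankOne ℝ (x i) (x i)

open Classical in
/-- The thresholded projection estimator with dimension `m` and threshold `γ`, as a function of the
data: `∑_{l ≤ m} (Γ̂_m⁻¹ ĝ_m)_l ψ_l` if `Γ̂_m` is nonsingular with `‖Γ̂_m⁻¹‖ ≤ γ`, and `0`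
otherwise. -/
noncomputable def estimator (ψ : HilbertBasis ℕ ℝ L2I) (m : ℕ) (γ : ℝ) {n : ℕ}
    (y : Fin n → ℝ) (x : Fin n → L2I) : L2I :=
  if IsUnit (opMatrix ψ m (empCov x)) ∧ specNorm (opMatrix ψ m (empCov x))⁻¹ ≤ γ then
    ∑ l : Fin m, (opMatrix ψ m (empCov x))⁻¹.mulVec (coeffVec ψ m (empCross y x)) l • ψ l
  else 0

end FunLinReg

open FunLinReg

/-! Let `f` be the Galerkin solution: the element of the span of the first `m` basis functions for
which `Γ f` and `Γ β` have the same first `m` coefficients. The error splits into the bias `f - β`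
and a stochastic part `v`, the coefficient vector of the estimator minus that of `f`.

Bias. The link condition makes `Γ` comparable in norm to the diagonal operator `D` with eigenvalues
`υ`. Hence the Galerkin scheme is stable in the norm `‖D ·‖`, and monotonicity of `υ² / ω` transfers
this to the `ω`-norm. The bias is at most a constant times the tail of `β`, which vanishes because
`ω ≤ b`.

Stochastic part. By Löwner–Heinz, `D ≤ d Γ` as forms, so `‖v‖_ω²` is at most `d · sup (ω / υ)` times
the population form of `v`. The normal equations express the empirical form of `v` through centred
scores, residual times standardized regressor. Where the empirical form dominates a fixed multiple
of the population form, Cauchy–Schwarz gives a bound of mean order `m / n`.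

Four moments give that domination only up to probability of order `m² / n`, which need not offset
the threshold `1 / υ_m`. But a lower bound on the empirical form needs just one good subsample,
since the other observations contribute squares. Five disjoint blocks all fail with probability of
order `(m² / n)^5`. There the threshold costs `1 / υ_m`, and Cauchy–Schwarz leaves `υ_m⁻¹ (m² /
n)^(5/2)`, which is `O(m / n)` by the last growth condition and `m υ_m ≤ ∑ υ`.

Finally, the estimator is set to zero only if the full standardized Gram matrix is far from the
identity, an event of probability `O(m² / n)` on which the loss is `‖β‖_ω²`. -/

section Auxiliary

open scoped Matrix

/-! ### Löwner–Heinz inequality for the square root -/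

section LoewnerHeinz

variable {E : Type*} [NormedAddCommGroup E] [InnerProductSpace ℝ E]

/-- Positivity tested at `x - K⁻¹ T x` gives `T² ≤ K T` without constructing a square root of `T`.
-/
theorem norm_sq_apply_le_of_inner_nonneg {T : E →L[ℝ] E} (hs : ∀ x y, ⟪T x, y⟫ = ⟪x, T y⟫)
    (hT : ∀ x, 0 ≤ ⟪T x, x⟫) {K : ℝ} (hK : 0 < K) (hTK : ‖T‖ ≤ K) (x : E) :
    ‖T x‖ ^ 2 ≤ K * ⟪T x, x⟫ := by
  have h := hT (x - K⁻¹ • T x)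
  have h1 : ⟪T (T x), T x⟫ ≤ K * ‖T x‖ ^ 2 := by
    calc ⟪T (T x), T x⟫ ≤ ‖T (T x)‖ * ‖T x‖ := real_inner_le_norm _ _
      _ ≤ (K * ‖T x‖) * ‖T x‖ := by
          gcongr; exact (T.le_opNorm _).trans (by gcongr)
      _ = _ := by ring
  have h2 : ⟪T (T x), x⟫ = ‖T x‖ ^ 2 := by rw [hs, real_inner_self_eq_norm_sq]
  simp only [map_sub, map_smul, inner_sub_left, inner_sub_right, real_inner_smul_left,
    real_inner_smul_right, h2, real_inner_self_eq_norm_sq] at h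
  have h3 : K⁻¹ * (K⁻¹ * ⟪T (T x), T x⟫) ≤ K⁻¹ * ‖T x‖ ^ 2 := by
    have : K⁻¹ * (K⁻¹ * ⟪T (T x), T x⟫) ≤ K⁻¹ * (K⁻¹ * (K * ‖T x‖ ^ 2)) := by gcongr
    rwa [inv_mul_cancel_left₀ hK.ne'] at this
  have h4 : K⁻¹ * ‖T x‖ ^ 2 ≤ ⟪T x, x⟫ := by linarith
  calc ‖T x‖ ^ 2 = K * (K⁻¹ * ‖T x‖ ^ 2) := by field_simp
    _ ≤ _ := by gcongr

/-- The Löwner–Heinz inequality for the square root, in terms of quadratic forms. -/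
theorem inner_apply_le_of_norm_apply_le {A B : E →L[ℝ] E} (hA : ∀ x y, ⟪A x, y⟫ = ⟪x, A y⟫)
    (hB : ∀ x y, ⟪B x, y⟫ = ⟪x, B y⟫) (hB0 : ∀ x, 0 ≤ ⟪B x, x⟫)
    (h : ∀ x, ‖A x‖ ≤ ‖B x‖) (x : E) : ⟪A x, x⟫ ≤ ⟪B x, x⟫ := by
  -- Otherwise the infimum `μ` of the form of `B - A` on the unit sphere is negative. Approximate
  -- eigenvectors for `μ` then contradict `‖A v‖ ≤ ‖B v‖`.
  by_contra! hx
  set C : E →L[ℝ] E := B - A with hC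
  set S : Set ℝ := (fun v => ⟪C v, v⟫) '' {v : E | ‖v‖ = 1} with hS
  have hbdd : BddBelow S := by
    refine ⟨-‖C‖, ?_⟩
    rintro _ ⟨v, hv, rfl⟩
    have h1 := abs_real_inner_le_norm (C v) v
    have h2 := C.le_opNorm v
    rw [Set.mem_ofPred_eq] at hv
    rw [hv, mul_one] at h1 h2
    have := neg_abs_le ⟪C v, v⟫
    simp only
    linarith
  have hx0 : x ≠ 0 := by rintro rfl; simp at hx
  have hnx : 0 < ‖x‖ := norm_pos_iff.2 hx0
  set u : E := ‖x‖⁻¹ • x with hu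
  have hu1 : ‖u‖ = 1 := by rw [hu, norm_smul, norm_inv, norm_norm, inv_mul_cancel₀ hnx.ne']
  have huC : ⟪C u, u⟫ < 0 := by
    rw [hu, map_smul, real_inner_smul_left, real_inner_smul_right, hC, sub_apply,
      inner_sub_left]
    have : 0 < ‖x‖⁻¹ := inv_pos.2 hnx
    have h3 : ⟪B x, x⟫ - ⟪A x, x⟫ < 0 := by linarith
    exact mul_neg_of_pos_of_neg this (mul_neg_of_pos_of_neg this h3)
  set μ : ℝ := sInf S with hμ
  have hμ0 : μ < 0 := (csInf_le hbdd ⟨u, hu1, rfl⟩).trans_lt huC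
  have hSne : S.Nonempty := ⟨_, u, hu1, rfl⟩
  set T : E →L[ℝ] E := C - μ • ContinuousLinearMap.id ℝ E with hT
  have hTapp (v : E) : T v = C v - μ • v := by simp [hT]
  have hTs (v w : E) : ⟪T v, w⟫ = ⟪v, T w⟫ := by
    simp [hTapp, hC, inner_sub_left, inner_sub_right, real_inner_smul_left, real_inner_smul_right,
      hA, hB]
  have hT0 (v : E) : 0 ≤ ⟪T v, v⟫ := by
    rcases eq_or_ne v 0 with rfl | hv
    · simp
    have hnv : 0 < ‖v‖ := norm_pos_iff.2 hv
    have h1 : μ ≤ ⟪C (‖v‖⁻¹ • v), ‖v‖⁻¹ • v⟫ :=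
      csInf_le hbdd ⟨_, by simp [norm_smul, hnv.ne'], rfl⟩
    rw [map_smul, real_inner_smul_left, real_inner_smul_right] at h1
    rw [hTapp, inner_sub_left, real_inner_smul_left, real_inner_self_eq_norm_sq, sub_nonneg]
    calc μ * ‖v‖ ^ 2 ≤ (‖v‖⁻¹ * (‖v‖⁻¹ * ⟪C v, v⟫)) * ‖v‖ ^ 2 := by gcongr
      _ = _ := by field_simp
  set K : ℝ := ‖T‖ + 1 with hK
  have hK0 : 0 < K := by positivity
  have key (δ : ℝ) (hδ : 0 < δ) : μ ^ 2 ≤ -μ * δ + √(K * δ) * ‖A + B‖ := by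
    obtain ⟨_, ⟨v, hv, rfl⟩, hvδ⟩ := exists_lt_of_csInf_lt hSne (lt_add_of_pos_right μ hδ)
    rw [Set.mem_ofPred_eq] at hv
    simp only at hvδ
    have h1 : ‖T v‖ ≤ √(K * δ) := by
      refine Real.le_sqrt_of_sq_le ?_
      refine (norm_sq_apply_le_of_inner_nonneg hTs hT0 hK0 (by linarith) v).trans ?_
      gcongr
      rw [hTapp, inner_sub_left, real_inner_smul_left, real_inner_self_eq_norm_sq, hv]
      linarith
    -- Cross terms cancel in `(B - A)` against `(A + B)`, so the hypothesis on norms fixes the sign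
    -- of this pairing.
    have h2 : ⟪C v, (A + B) v⟫ = ‖B v‖ ^ 2 - ‖A v‖ ^ 2 := by
      simp only [hC, sub_apply, add_apply, inner_sub_left,
        inner_add_right, real_inner_self_eq_norm_sq, real_inner_comm (A v) (B v)]
      ring
    have h3 : 0 ≤ ⟪C v, (A + B) v⟫ := by
      rw [h2, sub_nonneg]; gcongr; exact h v
    have h4 : C v = T v + μ • v := by rw [hTapp]; abel
    rw [h4, inner_add_left, real_inner_smul_left] at h3
    have h5 : ⟪T v, (A + B) v⟫ ≤ √(K * δ) * ‖A + B‖ := by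
      refine (real_inner_le_norm _ _).trans ?_
      gcongr
      simpa [hv] using (A + B).le_opNorm v
    -- Here `A + B = 2 B - C`, with `B` nonnegative and the form of `C` at `v` below `μ + δ`.
    have h6 : -μ - δ ≤ ⟪v, (A + B) v⟫ := by
      have e1 : ⟪C v, v⟫ = ⟪B v, v⟫ - ⟪A v, v⟫ := by simp [hC, inner_sub_left]
      have e2 : ⟪v, (A + B) v⟫ = ⟪A v, v⟫ + ⟪B v, v⟫ := by
        rw [add_apply, inner_add_right, hA, hB]
      have := hB0 v
      rw [e2]
      linarith
    nlinarith
  have hlim : Tendsto (fun δ : ℝ => -μ * δ + √(K * δ) * ‖A + B‖) (𝓝[>] 0) (𝓝 0) := by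
    have : Continuous (fun δ : ℝ => -μ * δ + √(K * δ) * ‖A + B‖) := by fun_prop
    have h0 := this.tendsto 0
    simp only [mul_zero, Real.sqrt_zero, zero_mul, add_zero] at h0
    exact h0.mono_left nhdsWithin_le_nhds
  have := ge_of_tendsto hlim (eventually_nhdsWithin_of_forall fun δ hδ => key δ hδ)
  nlinarith

end LoewnerHeinz

/-! ### The diagonal operator attached to the weights -/

section DiagonalOperator

theorem hasSum_inner_sq (ψ : HilbertBasis ℕ ℝ L2I) (f : L2I) :
    HasSum (fun j => ⟪ψ j, f⟫ ^ 2) (‖f‖ ^ 2) := by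
  have := ψ.hasSum_inner_mul_inner f f
  rw [real_inner_self_eq_norm_sq] at this
  simpa only [real_inner_comm f, ← sq] using this

theorem weightedNormSq_one (ψ : HilbertBasis ℕ ℝ L2I) (f : L2I) :
    weightedNormSq ψ (fun _ => 1) f = ENNReal.ofReal (‖f‖ ^ 2) := by
  simp only [weightedNormSq, one_mul]
  rw [← ENNReal.ofReal_tsum_of_nonneg (fun j => sq_nonneg _) (hasSum_inner_sq ψ f).summable,
    (hasSum_inner_sq ψ f).tsum_eq]

/-- The operator `f ↦ ∑ υ_j ⟨ψ_j, f⟩ ψ_j`. -/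
noncomputable def diagOp (ψ : HilbertBasis ℕ ℝ L2I) (υ : ℕ → ℝ) : L2I →L[ℝ] L2I :=
  ∑' j, υ j • InnerProductSpace.rankOne ℝ (ψ j) (ψ j)

variable {ψ : HilbertBasis ℕ ℝ L2I} {υ : ℕ → ℝ}

theorem inner_diagOp (hυ : Summable υ) (i : ℕ) (f : L2I) :
    ⟪ψ i, diagOp ψ υ f⟫ = υ i * ⟪ψ i, f⟫ := by
  have hs : Summable fun j => υ j • InnerProductSpace.rankOne ℝ (ψ j) (ψ j) := by
    refine Summable.of_norm ?_
    simpa [norm_smul, ψ.orthonormal.1] using hυ.abs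
  have h1 : HasSum (fun j => ⟪ψ i, (υ j • InnerProductSpace.rankOne ℝ (ψ j) (ψ j)) f⟫)
      ⟪ψ i, diagOp ψ υ f⟫ :=
    ((hs.hasSum.mapL (ContinuousLinearMap.apply ℝ L2I f)).mapL (innerSL ℝ (ψ i)))
  refine h1.unique ?_
  have h2 := hasSum_single (f := fun j =>
    ⟪ψ i, (υ j • InnerProductSpace.rankOne ℝ (ψ j) (ψ j)) f⟫) i fun j hj => by
      simp [inner_smul_right, ψ.orthonormal.2 hj.symm]
  simpa [inner_smul_right, ψ.orthonormal.1] using h2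

theorem hasSum_inner_diagOp (hυ : Summable υ) (f g : L2I) :
    HasSum (fun j => υ j * (⟪ψ j, f⟫ * ⟪ψ j, g⟫)) ⟪diagOp ψ υ f, g⟫ := by
  convert! ψ.hasSum_inner_mul_inner (diagOp ψ υ f) g using 2 with j
  rw [real_inner_comm (ψ j), inner_diagOp hυ]; ring

theorem inner_diagOp_comm (hυ : Summable υ) (f g : L2I) :
    ⟪diagOp ψ υ f, g⟫ = ⟪f, diagOp ψ υ g⟫ := by
  rw [real_inner_comm _ f]
  refine (hasSum_inner_diagOp hυ f g).unique ?_
  convert! hasSum_inner_diagOp (ψ := ψ) hυ g f using 3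
  ring

theorem weightedNormSq_sq (hυ : Summable υ) (f : L2I) :
    weightedNormSq ψ (fun j => υ j ^ 2) f = ENNReal.ofReal (‖diagOp ψ υ f‖ ^ 2) := by
  rw [← weightedNormSq_one ψ]
  simp only [weightedNormSq, inner_diagOp hυ, one_mul, mul_pow]

end DiagonalOperator

/-! ### Consequences of the link condition -/

section Link

variable {ψ : HilbertBasis ℕ ℝ L2I} {υ : ℕ → ℝ} {d : ℝ} {Γ : L2I →L[ℝ] L2I}

theorem FunLinReg.LinkClass.norm_apply_le (h : LinkClass ψ υ d Γ) (hυ : Summable υ) (hd : 1 ≤ d) (f : L2I) :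
    ‖Γ f‖ ≤ d * ‖diagOp ψ υ f‖ := by
  have := h.upper f
  rw [weightedNormSq_sq hυ, ← ENNReal.ofReal_mul (sq_nonneg _),
    ENNReal.ofReal_le_ofReal_iff (by positivity), ← mul_pow] at this
  exact le_of_sq_le_sq this (by positivity)

theorem FunLinReg.LinkClass.norm_diagOp_le (h : LinkClass ψ υ d Γ) (hυ : Summable υ) (hd : 1 ≤ d) (f : L2I) :
    ‖diagOp ψ υ f‖ ≤ d * ‖Γ f‖ := by
  have hd2 : 0 < d ^ 2 := by positivity
  have := h.lower f
  rw [weightedNormSq_sq hυ, ← ENNReal.ofReal_div_of_pos hd2,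
    ENNReal.ofReal_le_ofReal_iff (by positivity), div_le_iff₀ hd2, ← mul_pow] at this
  rw [mul_comm]
  exact le_of_sq_le_sq this (by positivity)

theorem FunLinReg.LinkClass.inner_comm (h : LinkClass ψ υ d Γ) (f g : L2I) : ⟪Γ f, g⟫ = ⟪f, Γ g⟫ :=
  h.selfAdjoint.isSymmetric f g

/-- The link condition compares squares of operators; Löwner–Heinz brings it down to the operators
themselves. Coercivity of the matrices `[Γ]_m` comes from here. -/
theorem FunLinReg.LinkClass.inner_diagOp_le (h : LinkClass ψ υ d Γ) (hυ : Summable υ) (hd : 1 ≤ d)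
    (hΓ : ∀ f, 0 ≤ ⟪Γ f, f⟫) (f : L2I) :
    ⟪diagOp ψ υ f, f⟫ ≤ d * ⟪Γ f, f⟫ := by
  have := inner_apply_le_of_norm_apply_le (A := diagOp ψ υ) (B := d • Γ)
    (inner_diagOp_comm hυ) (fun x y => by
      simp [real_inner_smul_left, real_inner_smul_right, h.inner_comm])
    (fun x => by
      simpa [real_inner_smul_left] using mul_nonneg (by linarith) (hΓ x))
    (fun x => by
      simpa [norm_smul, abs_of_nonneg (zero_le_one.trans hd)] using h.norm_diagOp_le hυ hd x) f
  simpa [real_inner_smul_left] using this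

end Link

/-! ### Galerkin approximation and its bias -/

section Galerkin

/-- The element `∑_{l ≤ m} v_l ψ_l`. -/
noncomputable def synth (ψ : HilbertBasis ℕ ℝ L2I) {m : ℕ} (v : Fin m → ℝ) : L2I :=
  ∑ l : Fin m, v l • ψ l

variable {ψ : HilbertBasis ℕ ℝ L2I} {m : ℕ}

theorem inner_synth (v : Fin m → ℝ) (g : L2I) : ⟪synth ψ v, g⟫ = v ⬝ᵥ coeffVec ψ m g := by
  simp [synth, sum_inner, real_inner_smul_left, dotProduct, coeffVec]

theorem inner_basis_synth (v : Fin m → ℝ) (j : ℕ) :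
    ⟪ψ j, synth ψ v⟫ = if h : j < m then v ⟨j, h⟩ else 0 := by
  rw [real_inner_comm, inner_synth]
  simp only [dotProduct, coeffVec, orthonormal_iff_ite.1 ψ.orthonormal]
  split_ifs with h
  · rw [Finset.sum_eq_single ⟨j, h⟩] <;> simp +contextual [Fin.ext_iff]
  · refine Finset.sum_eq_zero fun i _ => ?_
    rw [if_neg (by omega), mul_zero]

theorem coeffVec_synth (v : Fin m → ℝ) : coeffVec ψ m (synth ψ v) = v := by
  ext i; simp [coeffVec, inner_basis_synth]

theorem inner_synth_synth (v w : Fin m → ℝ) : ⟪synth ψ v, synth ψ w⟫ = v ⬝ᵥ w := by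
  rw [inner_synth, coeffVec_synth]

theorem synth_sub (v w : Fin m → ℝ) : synth ψ (v - w) = synth ψ v - synth ψ w := by
  simp [synth, sub_smul, Finset.sum_sub_distrib]

/-- The orthogonal projection onto the span of the first `m` basis functions. -/
noncomputable def basisProj (ψ : HilbertBasis ℕ ℝ L2I) (m : ℕ) (f : L2I) : L2I :=
  synth ψ (coeffVec ψ m f)

theorem inner_basisProj (f : L2I) (j : ℕ) :
    ⟪ψ j, basisProj ψ m f⟫ = if j < m then ⟪ψ j, f⟫ else 0 := by
  simp [basisProj, inner_basis_synth, coeffVec]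

theorem inner_eq_zero_of_disjoint_coeffs {f g : L2I} (hf : ∀ i < m, ⟪ψ i, f⟫ = 0)
    (hg : ∀ i, m ≤ i → ⟪ψ i, g⟫ = 0) : ⟪f, g⟫ = 0 := by
  rw [← ψ.tsum_inner_mul_inner f g]
  convert tsum_zero with i
  rcases lt_or_ge i m with h | h
  · rw [real_inner_comm, hf i h, zero_mul]
  · rw [hg i h, mul_zero]

theorem norm_basisProj_le (f : L2I) : ‖basisProj ψ m f‖ ≤ ‖f‖ := by
  have h := hasSum_le (fun j => ?_) (hasSum_inner_sq ψ (basisProj ψ m f)) (hasSum_inner_sq ψ f)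
  · exact le_of_sq_le_sq h (norm_nonneg _)
  · rw [inner_basisProj]
    split_ifs
    · rfl
    · simpa using sq_nonneg _

variable {υ : ℕ → ℝ} {c : ℝ}

theorem norm_diagOp_le_of_tail (hυ : Summable υ) (h0 : ∀ j, 0 ≤ υ j) (hc : ∀ j, m ≤ j → υ j ≤ c)
    {t : L2I} (ht : ∀ i < m, ⟪ψ i, t⟫ = 0) : ‖diagOp ψ υ t‖ ≤ c * ‖t‖ := by
  have hc0 : 0 ≤ c := (h0 m).trans (hc m le_rfl)
  have h := hasSum_le (fun j => ?_) (hasSum_inner_sq ψ (diagOp ψ υ t))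
    ((hasSum_inner_sq ψ t).mul_left (c ^ 2))
  · rw [← mul_pow] at h
    exact le_of_sq_le_sq h (by positivity)
  · rw [inner_diagOp hυ, mul_pow]
    rcases lt_or_ge j m with hj | hj
    · simp [ht j hj]
    · have := h0 j
      gcongr
      exact hc j hj

theorem mul_norm_sq_le_inner_diagOp (hυ : Summable υ) (hc : ∀ j < m, c ≤ υ j)
    {v : L2I} (hv : ∀ i, m ≤ i → ⟪ψ i, v⟫ = 0) : c * ‖v‖ ^ 2 ≤ ⟪diagOp ψ υ v, v⟫ := by
  refine hasSum_le (fun j => ?_) ((hasSum_inner_sq ψ v).mul_left c) (hasSum_inner_diagOp hυ v v)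
  rcases lt_or_ge j m with hj | hj
  · rw [← sq]
    gcongr
    exact hc j hj
  · simp [hv j hj]

variable {d : ℝ} {Γ : L2I →L[ℝ] L2I}

/-- Stability of the Galerkin solution in the norm weighted by `υ²`. -/
theorem FunLinReg.LinkClass.norm_diagOp_le_of_galerkin (h : LinkClass ψ υ d Γ) (hυ : Summable υ)
    (h0 : ∀ j, 0 ≤ υ j) (hd : 1 ≤ d) (hΓ : ∀ f, 0 ≤ ⟪Γ f, f⟫)
    (hc1 : ∀ j < m, c ≤ υ j) (hc2 : ∀ j, m ≤ j → υ j ≤ c) {v z : L2I}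
    (hv : ∀ i, m ≤ i → ⟪ψ i, v⟫ = 0) (hz : ∀ i < m, ⟪ψ i, Γ v⟫ = ⟪ψ i, z⟫) :
    ‖diagOp ψ υ v‖ ≤ d * (1 + d ^ 2) * ‖z‖ := by
  have hd0 : 0 ≤ d := zero_le_one.trans hd
  have hc0 : 0 ≤ c := (h0 m).trans (hc2 m le_rfl)
  have h1 : ⟪Γ v, v⟫ = ⟪z, v⟫ := by
    rw [← sub_eq_zero, ← inner_sub_left]
    exact inner_eq_zero_of_disjoint_coeffs (fun i hi => by rw [inner_sub_right, hz i hi, sub_self]) hv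
  -- Test the Galerkin equation with `v` itself; on the span the form of `Γ` is at least `c / d`.
  have h2 : c * ‖v‖ ≤ d * ‖z‖ := by
    rcases (norm_nonneg v).eq_or_lt with hv0 | hv0
    · rw [← hv0, mul_zero]; positivity
    refine le_of_mul_le_mul_right ?_ hv0
    calc c * ‖v‖ * ‖v‖ = c * ‖v‖ ^ 2 := by ring
      _ ≤ d * ⟪Γ v, v⟫ :=
        (mul_norm_sq_le_inner_diagOp hυ hc1 hv).trans (h.inner_diagOp_le hυ hd hΓ v)
      _ ≤ d * (‖z‖ * ‖v‖) := by rw [h1]; gcongr; exact real_inner_le_norm _ _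
      _ = _ := by ring
  set t : L2I := Γ v - basisProj ψ m z with ht
  have ht0 : ∀ i < m, ⟪ψ i, t⟫ = 0 := fun i hi => by
    rw [ht, inner_sub_right, inner_basisProj, if_pos hi, hz i hi, sub_self]
  -- Duality: `t` has only tail coefficients, so `Γ` shrinks it by `d c`, and this `c` compensates
  -- the loss in the bound on `‖v‖`.
  have h3 : ‖t‖ ≤ d ^ 2 * ‖z‖ := by
    rcases (norm_nonneg t).eq_or_lt with ht1 | ht1
    · rw [← ht1]; positivity
    refine le_of_mul_le_mul_left ?_ ht1
    have e1 : ⟪t, basisProj ψ m z⟫ = 0 := inner_eq_zero_of_disjoint_coeffs ht0 fun i hi => by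
      rw [inner_basisProj, if_neg (by omega)]
    calc ‖t‖ * ‖t‖ = ⟪t, Γ v - basisProj ψ m z⟫ := by rw [← ht, real_inner_self_eq_norm_mul_norm]
      _ = ⟪Γ t, v⟫ := by rw [inner_sub_right, e1, sub_zero, h.inner_comm]
      _ ≤ ‖Γ t‖ * ‖v‖ := real_inner_le_norm _ _
      _ ≤ (d * (c * ‖t‖)) * ‖v‖ := by
          gcongr
          refine (h.norm_apply_le hυ hd t).trans ?_
          gcongr
          exact norm_diagOp_le_of_tail hυ h0 hc2 ht0
      _ = ‖t‖ * (d * (c * ‖v‖)) := by ring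
      _ ≤ ‖t‖ * (d * (d * ‖z‖)) := by gcongr
      _ = _ := by ring
  calc ‖diagOp ψ υ v‖ ≤ d * ‖Γ v‖ := h.norm_diagOp_le hυ hd v
    _ = d * ‖basisProj ψ m z + t‖ := by rw [ht]; congr 2; abel
    _ ≤ d * (‖z‖ + d ^ 2 * ‖z‖) := by
        gcongr
        exact (norm_add_le _ _).trans (add_le_add (norm_basisProj_le z) h3)
    _ = _ := by ring

theorem weightedNormSq_le_mul {w w' : ℕ → ℝ} {K : ℝ} (hK : 0 ≤ K) {f g : L2I}
    (h : ∀ j, w j * ⟪ψ j, f⟫ ^ 2 ≤ K * (w' j * ⟪ψ j, g⟫ ^ 2)) :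
    weightedNormSq ψ w f ≤ ENNReal.ofReal K * weightedNormSq ψ w' g := by
  rw [weightedNormSq, weightedNormSq, ← ENNReal.tsum_mul_left]
  gcongr with j
  rw [← ENNReal.ofReal_mul hK]
  exact ENNReal.ofReal_le_ofReal (h j)

/-- The bias of the Galerkin solution is of the order of the best approximation. -/
theorem FunLinReg.LinkClass.weightedNormSq_galerkin_sub_le (h : LinkClass ψ υ d Γ)
    (hυ : Summable υ) (h0 : ∀ j, 0 ≤ υ j) (hd : 1 ≤ d) (hΓ : ∀ f, 0 ≤ ⟪Γ f, f⟫)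
    (hc1 : ∀ j < m, c ≤ υ j) (hc2 : ∀ j, m ≤ j → υ j ≤ c)
    {w : ℕ → ℝ} {K : ℝ} (hK : 0 ≤ K) (hK1 : ∀ j < m, w j ≤ K * υ j ^ 2)
    (hK2 : ∀ j, m ≤ j → K * υ j ^ 2 ≤ w j) {f β : L2I}
    (hf : ∀ i, m ≤ i → ⟪ψ i, f⟫ = 0) (hfβ : ∀ i < m, ⟪ψ i, Γ f⟫ = ⟪ψ i, Γ β⟫) :
    weightedNormSq ψ w (f - β) ≤ ENNReal.ofReal (1 + (d ^ 2 * (1 + d ^ 2)) ^ 2) *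
      weightedNormSq ψ w (β - basisProj ψ m β) := by
  set r := β - basisProj ψ m β with hr
  set e := f - basisProj ψ m β with he
  set C := d ^ 2 * (1 + d ^ 2) with hC
  have hd0 : 0 ≤ d := zero_le_one.trans hd
  have hC0 : 0 ≤ C := by positivity
  have he0 : ∀ i, m ≤ i → ⟪ψ i, e⟫ = 0 := fun i hi => by
    rw [he, inner_sub_right, hf i hi, inner_basisProj, if_neg (by omega), sub_zero]
  have hr0 : ∀ i < m, ⟪ψ i, r⟫ = 0 := fun i hi => by
    rw [hr, inner_sub_right, inner_basisProj, if_pos hi, sub_self]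
  have hfe : f - β = e - r := by rw [he, hr]; abel
  -- The difference `e` is itself a Galerkin solution, with data `Γ r`.
  have hD : ‖diagOp ψ υ e‖ ≤ C * ‖diagOp ψ υ r‖ := by
    have h1 := h.norm_diagOp_le_of_galerkin hυ h0 hd hΓ hc1 hc2 he0 (z := Γ r) fun i hi => by
      rw [he, hr, map_sub, map_sub, inner_sub_right, inner_sub_right, hfβ i hi]
    calc _ ≤ d * (1 + d ^ 2) * ‖Γ r‖ := h1
      _ ≤ d * (1 + d ^ 2) * (d * ‖diagOp ψ υ r‖) := by gcongr; exact h.norm_apply_le hυ hd r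
      _ = _ := by ring
  have h1 : weightedNormSq ψ w (f - β) ≤ weightedNormSq ψ w e + weightedNormSq ψ w r := by
    rw [weightedNormSq, weightedNormSq, weightedNormSq, ← ENNReal.tsum_add]
    gcongr with j
    rw [hfe, inner_sub_right]
    rcases lt_or_ge j m with hj | hj
    · simp [hr0 j hj]
    · simp [he0 j hj]
  -- The constant `K` exchanges `w` for `υ²`, upwards on the head that carries `e` and downwards on
  -- the tail that carries `r`; it cancels between the two.
  have h2 : weightedNormSq ψ w e ≤ ENNReal.ofReal K * ENNReal.ofReal (‖diagOp ψ υ e‖ ^ 2) := by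
    rw [← weightedNormSq_sq hυ]
    refine weightedNormSq_le_mul hK fun j => ?_
    rcases lt_or_ge j m with hj | hj
    · rw [← mul_assoc]; gcongr; exact hK1 j hj
    · simp [he0 j hj]
  have h3 : ENNReal.ofReal K * ENNReal.ofReal (‖diagOp ψ υ r‖ ^ 2) ≤ weightedNormSq ψ w r := by
    rw [← weightedNormSq_sq hυ, weightedNormSq, weightedNormSq, ← ENNReal.tsum_mul_left]
    gcongr with j
    rw [← ENNReal.ofReal_mul hK]
    refine ENNReal.ofReal_le_ofReal ?_
    rcases lt_or_ge j m with hj | hj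
    · simp [hr0 j hj]
    · rw [← mul_assoc]; gcongr; exact hK2 j hj
  have h4 : ENNReal.ofReal (‖diagOp ψ υ e‖ ^ 2)
      ≤ ENNReal.ofReal (C ^ 2) * ENNReal.ofReal (‖diagOp ψ υ r‖ ^ 2) := by
    rw [← ENNReal.ofReal_mul (by positivity), ← mul_pow]
    gcongr
  calc _ ≤ weightedNormSq ψ w e + weightedNormSq ψ w r := h1
    _ ≤ ENNReal.ofReal (C ^ 2) * weightedNormSq ψ w r + weightedNormSq ψ w r := by
      gcongr
      calc _ ≤ _ := h2
        _ ≤ ENNReal.ofReal K * (ENNReal.ofReal (C ^ 2) * ENNReal.ofReal (‖diagOp ψ υ r‖ ^ 2)) := by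
          gcongr
        _ = ENNReal.ofReal (C ^ 2) * (ENNReal.ofReal K * ENNReal.ofReal (‖diagOp ψ υ r‖ ^ 2)) := by
          ring
        _ ≤ _ := by gcongr
    _ = _ := by
      rw [ENNReal.ofReal_add zero_le_one (by positivity), ENNReal.ofReal_one]; ring

theorem tendsto_weightedNormSq_sub_basisProj {w : ℕ → ℝ} {β : L2I}
    (hβ : weightedNormSq ψ w β ≠ ∞) :
    Tendsto (fun m => weightedNormSq ψ w (β - basisProj ψ m β)) atTop (𝓝 0) := by
  convert ENNReal.tendsto_sum_nat_add _ hβ with m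
  rw [weightedNormSq, ← ENNReal.summable.sum_add_tsum_nat_add' (k := m), Finset.sum_eq_zero, zero_add]
  · congr 1; ext k
    rw [inner_sub_right, inner_basisProj, if_neg (by omega), sub_zero]
  · intro i hi
    rw [inner_sub_right, inner_basisProj, if_pos (Finset.mem_range.1 hi)]; simp

end Galerkin

/-! ### Second moments of products -/

theorem memLp_two_mul_of_integrable_pow_four {Ω₀ : Type*} [MeasurableSpace Ω₀] {P₀ : Measure Ω₀}
    {f g : Ω₀ → ℝ} (hf : AEMeasurable f P₀) (hg : AEMeasurable g P₀)
    (hf4 : Integrable (fun w => f w ^ 4) P₀) (hg4 : Integrable (fun w => g w ^ 4) P₀) :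
    MemLp (fun w => f w * g w) 2 P₀ := by
  have hm : AEMeasurable (fun w => f w * g w) P₀ := hf.mul hg
  rw [memLp_two_iff_integrable_sq hm.aestronglyMeasurable]
  refine (hf4.add hg4).mono' (hm.pow_const 2).aestronglyMeasurable ?_
  refine Eventually.of_forall fun w => ?_
  rw [Real.norm_of_nonneg (sq_nonneg _)]
  simp only [Pi.add_apply]
  nlinarith [sq_nonneg (f w ^ 2 - g w ^ 2), sq_nonneg (f w ^ 2), sq_nonneg (g w ^ 2)]

theorem integral_mul_sq_le {Ω₀ : Type*} [MeasurableSpace Ω₀] {P₀ : Measure Ω₀}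
    {f g : Ω₀ → ℝ} (hf : AEMeasurable f P₀) (hg : AEMeasurable g P₀)
    (hf4 : Integrable (fun w => f w ^ 4) P₀) (hg4 : Integrable (fun w => g w ^ 4) P₀) :
    ∫ w, (f w * g w) ^ 2 ∂P₀ ≤ (∫ w, f w ^ 4 ∂P₀ + ∫ w, g w ^ 4 ∂P₀) / 2 := by
  rw [← integral_add hf4 hg4, ← integral_div]
  refine integral_mono (memLp_two_mul_of_integrable_pow_four hf hg hf4 hg4).integrable_sq
    ((hf4.add hg4).div_const 2) fun w => ?_
  simp only
  nlinarith [sq_nonneg (f w ^ 2 - g w ^ 2)]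

/-! ### Independent copies, Gram deviations and disjoint blocks -/

section IndependentCopies

variable {Ω' Ω₀ α : Type*} [MeasurableSpace Ω'] [MeasurableSpace Ω₀] [MeasurableSpace α] {n : ℕ}
  {P' : Measure Ω'} {P₀ : Measure Ω₀} {ξ : Fin n → Ω' → α} {ξ₀ : Ω₀ → α}

theorem lintegral_sq_sum_copies [IsProbabilityMeasure P'] (hind : iIndepFun ξ P')
    (hid : ∀ i, IdentDistrib (ξ i) ξ₀ P' P₀) {h : α → ℝ} (hm : Measurable h)
    (h2 : MemLp (fun w => h (ξ₀ w)) 2 P₀) (h0 : ∫ w, h (ξ₀ w) ∂P₀ = 0) (s : Finset (Fin n)) :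
    ∫⁻ w, ENNReal.ofReal ((∑ i ∈ s, h (ξ i w)) ^ 2) ∂P'
      = ENNReal.ofReal (s.card * ∫ w, h (ξ₀ w) ^ 2 ∂P₀) := by
  have hid' (i : Fin n) : IdentDistrib (fun w => h (ξ i w)) (fun w => h (ξ₀ w)) P' P₀ :=
    (hid i).comp hm
  have hL (i : Fin n) : MemLp (fun w => h (ξ i w)) 2 P' := (hid' i).symm.memLp_snd h2
  have hS : MemLp (∑ i ∈ s, fun w => h (ξ i w)) 2 P' := memLp_finsetSum' s fun i _ => hL i
  have hSi : ∫ w, (∑ i ∈ s, fun w => h (ξ i w)) w ∂P' = 0 := by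
    simp only [Finset.sum_apply]
    rw [integral_finsetSum _ fun i _ => (hL i).integrable one_le_two]
    exact Finset.sum_eq_zero fun i _ => by rw [(hid' i).integral_eq, h0]
  have hv := IndepFun.variance_sum (μ := P') (X := fun i w => h (ξ i w)) (s := s) (fun i _ => hL i)
    fun i _ j _ hij => (hind.indepFun hij).comp hm hm
  rw [variance_of_integral_eq_zero hS.aemeasurable hSi] at hv
  have hv' (i : Fin n) : variance (fun w => h (ξ i w)) P' = ∫ w, h (ξ₀ w) ^ 2 ∂P₀ := by
    rw [(hid' i).variance_eq, variance_of_integral_eq_zero h2.aemeasurable h0]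
  simp only [hv', Finset.sum_const, nsmul_eq_mul, Finset.sum_apply] at hv
  rw [← hv, ofReal_integral_eq_lintegral_ofReal]
  · simpa using hS.integrable_sq
  · exact Eventually.of_forall fun w => sq_nonneg _

/-- Induction on the set of blocks: the remaining events together depend only on the observations in
the union of their blocks, which is disjoint from the new block. -/
theorem measure_biInter_blocks [IsProbabilityMeasure P'] (hind : iIndepFun ξ P')
    (hξ : ∀ i, AEMeasurable (ξ i) P') {κ : Type*} [DecidableEq κ] {T : κ → Finset (Fin n)}
    (hT : Pairwise fun b c => Disjoint (T b) (T c)) {A : ∀ b, Set (T b → α)}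
    (hA : ∀ b, MeasurableSet (A b)) (t : Finset κ) :
    P' (⋂ b ∈ t, {w | (fun i : T b => ξ i w) ∈ A b})
      = ∏ b ∈ t, P' {w | (fun i : T b => ξ i w) ∈ A b} := by
  induction t using Finset.induction_on with
  | empty => simp
  | insert b t hb ih =>
    rw [Finset.prod_insert hb, ← ih, Finset.set_biInter_insert]
    have hdisj : Disjoint (T b) (t.biUnion T) := by
      rw [Finset.disjoint_biUnion_right]
      exact fun c hc => hT (by rintro rfl; exact hb hc)
    have hi := hind.indepFun_finset₀ (T b) (t.biUnion T) hdisj hξ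
    have hsub (c : t) : T c ⊆ t.biUnion T := Finset.subset_biUnion_of_mem T c.2
    have hB : MeasurableSet (⋂ c : t, {g : ↥(t.biUnion T) → α |
        (fun i : T c => g ⟨i, hsub c i.2⟩) ∈ A c}) := by
      refine MeasurableSet.iInter fun c => ?_
      refine (hA c).preimage (f := fun g : ↥(t.biUnion T) → α =>
        fun i : T c => g ⟨i, hsub c i.2⟩) ?_
      exact measurable_pi_lambda _ fun i => measurable_pi_apply _
    have := hi.measure_inter_preimage_eq_mul _ _ (hA b) hB
    convert! this using 2
    · ext w; simp
    · congr 1; ext w; simp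

/-- The squared Frobenius norm of `∑_{i ∈ s} (z zᵀ - 1)(ξ_i)`. -/
noncomputable def gramDev {m : ℕ} (z : Fin m → α → ℝ) (s : Finset (Fin n)) (x : Fin n → α) : ℝ :=
  ∑ j, ∑ k, (∑ i ∈ s, (z j (x i) * z k (x i) - (1 : Matrix (Fin m) (Fin m) ℝ) j k)) ^ 2

variable {m : ℕ} {z : Fin m → α → ℝ} {η : ℝ}

/-- Each of the `m²` entries is a sum of centred independent copies, whose variance is bounded by
the fourth moments. -/
theorem lintegral_gramDev_le [IsProbabilityMeasure P'] [IsProbabilityMeasure P₀]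
    (hind : iIndepFun ξ P')
    (hid : ∀ i, IdentDistrib (ξ i) ξ₀ P' P₀) (hξ₀ : AEMeasurable ξ₀ P₀) (hz : ∀ j, Measurable (z j))
    (h4 : ∀ j, Integrable (fun w => z j (ξ₀ w) ^ 4) P₀) (h4' : ∀ j, ∫ w, z j (ξ₀ w) ^ 4 ∂P₀ ≤ η)
    (h1 : ∀ j k, ∫ w, z j (ξ₀ w) * z k (ξ₀ w) ∂P₀ = (1 : Matrix (Fin m) (Fin m) ℝ) j k)
    (s : Finset (Fin n)) :
    ∫⁻ w, ENNReal.ofReal (gramDev z s fun i => ξ i w) ∂P'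
      ≤ ENNReal.ofReal (s.card * (m ^ 2 * η)) := by
  have hzm (j : Fin m) : AEMeasurable (fun w => z j (ξ₀ w)) P₀ := (hz j).comp_aemeasurable hξ₀
  have hzz (j k : Fin m) : MemLp (fun w => z j (ξ₀ w) * z k (ξ₀ w)) 2 P₀ :=
    memLp_two_mul_of_integrable_pow_four (hzm j) (hzm k) (h4 j) (h4 k)
  have hterm (j k : Fin m) : ∫⁻ w, ENNReal.ofReal ((∑ i ∈ s, (z j (ξ i w) * z k (ξ i w)
      - (1 : Matrix (Fin m) (Fin m) ℝ) j k)) ^ 2) ∂P' ≤ ENNReal.ofReal (s.card * η) := by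
    set δ := (1 : Matrix (Fin m) (Fin m) ℝ) j k
    rw [lintegral_sq_sum_copies hind hid (h := fun x => z j x * z k x - δ)
      (((hz j).mul (hz k)).sub_const _) ((hzz j k).sub (memLp_const _)) ?_ s]
    · refine ENNReal.ofReal_le_ofReal ?_
      gcongr
      have e1 (w : Ω₀) : (z j (ξ₀ w) * z k (ξ₀ w) - δ) ^ 2
          = (z j (ξ₀ w) * z k (ξ₀ w)) ^ 2 - 2 * δ * (z j (ξ₀ w) * z k (ξ₀ w)) + δ ^ 2 := by ring
      simp only [e1]
      have i1 := (hzz j k).integrable_sq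
      have i2 := ((hzz j k).integrable one_le_two).const_mul (2 * δ)
      have e0 := integral_add (i1.sub i2) (integrable_const (δ ^ 2))
      simp only [Pi.sub_apply] at e0
      rw [e0, integral_sub i1 i2, integral_const_mul, h1]
      have := integral_mul_sq_le (hzm j) (hzm k) (h4 j) (h4 k)
      have e2 := h4' j
      have e3 := h4' k
      change _ - 2 * δ * δ + _ ≤ _
      simp only [integral_const, probReal_univ, smul_eq_mul, one_mul]
      nlinarith [sq_nonneg δ]
    · rw [integral_sub ((hzz j k).integrable one_le_two) (integrable_const _), h1]
      simp [δ]
  calc ∫⁻ w, ENNReal.ofReal (gramDev z s fun i => ξ i w) ∂P'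
      = ∫⁻ w, ∑ j, ∑ k, ENNReal.ofReal ((∑ i ∈ s, (z j (ξ i w) * z k (ξ i w)
          - (1 : Matrix (Fin m) (Fin m) ℝ) j k)) ^ 2) ∂P' := by
        congr 1; ext w
        rw [gramDev, ENNReal.ofReal_sum_of_nonneg fun _ _ => Finset.sum_nonneg fun _ _ => sq_nonneg _]
        congr 1; ext j
        rw [ENNReal.ofReal_sum_of_nonneg fun _ _ => sq_nonneg _]
    _ = ∑ j, ∑ k, ∫⁻ w, ENNReal.ofReal ((∑ i ∈ s, (z j (ξ i w) * z k (ξ i w)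
          - (1 : Matrix (Fin m) (Fin m) ℝ) j k)) ^ 2) ∂P' := by
        have hmeas (j k : Fin m) : AEMeasurable (fun w => ENNReal.ofReal
            ((∑ i ∈ s, (z j (ξ i w) * z k (ξ i w)
              - (1 : Matrix (Fin m) (Fin m) ℝ) j k)) ^ 2)) P' := by
          refine ((Finset.aemeasurable_fun_sum s fun i _ => ?_).pow_const 2).ennreal_ofReal
          have hi := (hid i).aemeasurable_fst
          exact (((hz j).comp_aemeasurable hi).mul ((hz k).comp_aemeasurable hi)).sub_const _
        rw [lintegral_finsetSum' _ fun j _ => Finset.aemeasurable_fun_sum _ fun k _ => hmeas j k]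
        congr 1; ext j
        rw [lintegral_finsetSum' _ fun k _ => hmeas j k]
    _ ≤ ∑ _j : Fin m, ∑ _k : Fin m, ENNReal.ofReal (s.card * η) := by
        gcongr with j _ k _; exact hterm j k
    _ = ENNReal.ofReal (s.card * (m ^ 2 * η)) := by
        simp only [Finset.sum_const, Finset.card_univ, Fintype.card_fin, nsmul_eq_mul]
        rw [← mul_assoc, ← ENNReal.ofReal_natCast, ← ENNReal.ofReal_mul (by positivity),
          ← ENNReal.ofReal_mul (by positivity)]
        congr 1; ring

theorem measure_gramDev_gt_le [IsProbabilityMeasure P'] [IsProbabilityMeasure P₀]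
    (hind : iIndepFun ξ P')
    (hid : ∀ i, IdentDistrib (ξ i) ξ₀ P' P₀) (hξ₀ : AEMeasurable ξ₀ P₀) (hz : ∀ j, Measurable (z j))
    (h4 : ∀ j, Integrable (fun w => z j (ξ₀ w) ^ 4) P₀) (h4' : ∀ j, ∫ w, z j (ξ₀ w) ^ 4 ∂P₀ ≤ η)
    (h1 : ∀ j k, ∫ w, z j (ξ₀ w) * z k (ξ₀ w) ∂P₀ = (1 : Matrix (Fin m) (Fin m) ℝ) j k)
    {s : Finset (Fin n)} (hs : s.Nonempty) :
    P' {w | (s.card : ℝ) ^ 2 / 4 < gramDev z s fun i => ξ i w}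
      ≤ ENNReal.ofReal (4 * m ^ 2 * η / s.card) := by
  have hc : (0 : ℝ) < s.card := by exact_mod_cast hs.card_pos
  have hmeas : AEMeasurable (fun w => ENNReal.ofReal (gramDev z s fun i => ξ i w)) P' := by
    unfold gramDev
    refine (Finset.aemeasurable_fun_sum _ fun j _ => Finset.aemeasurable_fun_sum _ fun k _ =>
      ((Finset.aemeasurable_fun_sum s fun i _ => ?_).pow_const 2)).ennreal_ofReal
    have hi := (hid i).aemeasurable_fst
    exact (((hz j).comp_aemeasurable hi).mul ((hz k).comp_aemeasurable hi)).sub_const _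
  have hε : ENNReal.ofReal ((s.card : ℝ) ^ 2 / 4) ≠ 0 := by
    rw [Ne, ENNReal.ofReal_eq_zero, not_le]; positivity
  calc _ ≤ P' {w | ENNReal.ofReal ((s.card : ℝ) ^ 2 / 4)
        ≤ ENNReal.ofReal (gramDev z s fun i => ξ i w)} :=
        measure_mono fun w hw => ENNReal.ofReal_le_ofReal (le_of_lt hw)
    _ ≤ _ := meas_ge_le_lintegral_div hmeas hε ENNReal.ofReal_ne_top
    _ ≤ ENNReal.ofReal (s.card * (m ^ 2 * η)) / ENNReal.ofReal ((s.card : ℝ) ^ 2 / 4) := by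
        gcongr; exact lintegral_gramDev_le hind hid hξ₀ hz h4 h4' h1 s
    _ = _ := by
        rw [← ENNReal.ofReal_div_of_pos (by positivity)]
        congr 1; field_simp

/-- Independence of the blocks raises the Markov bound to the power `q`, a decay obtained with no
more than four moments. -/
theorem measure_gramDev_gt_blocks_le [IsProbabilityMeasure P'] [IsProbabilityMeasure P₀]
    (hind : iIndepFun ξ P')
    (hid : ∀ i, IdentDistrib (ξ i) ξ₀ P' P₀) (hξ₀ : AEMeasurable ξ₀ P₀) (hz : ∀ j, Measurable (z j))
    (h4 : ∀ j, Integrable (fun w => z j (ξ₀ w) ^ 4) P₀) (h4' : ∀ j, ∫ w, z j (ξ₀ w) ^ 4 ∂P₀ ≤ η)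
    (h1 : ∀ j k, ∫ w, z j (ξ₀ w) * z k (ξ₀ w) ∂P₀ = (1 : Matrix (Fin m) (Fin m) ℝ) j k)
    {q k : ℕ} (hk : 0 < k) {T : Fin q → Finset (Fin n)}
    (hT : Pairwise fun b c => Disjoint (T b) (T c)) (hTc : ∀ b, (T b).card = k) :
    P' {w | ∀ b, (k : ℝ) ^ 2 / 4 < gramDev z (T b) fun i => ξ i w}
      ≤ ENNReal.ofReal (4 * m ^ 2 * η / k) ^ q := by
  let A : ∀ b, Set (T b → α) := fun b => {x | (k : ℝ) ^ 2 / 4 <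
    ∑ j, ∑ l, (∑ i, (z j (x i) * z l (x i) - (1 : Matrix (Fin m) (Fin m) ℝ) j l)) ^ 2}
  have hA (b) : MeasurableSet (A b) := by
    refine measurableSet_lt measurable_const ?_
    refine Finset.measurable_fun_sum _ fun j _ => Finset.measurable_fun_sum _ fun l _ =>
      ((Finset.measurable_fun_sum _ fun i _ => ?_).pow_const 2)
    exact (((hz j).comp (measurable_pi_apply i)).mul
      ((hz l).comp (measurable_pi_apply i))).sub_const _
  have hEq (b) : {w | (fun i : T b => ξ i w) ∈ A b}
      = {w | (k : ℝ) ^ 2 / 4 < gramDev z (T b) fun i => ξ i w} := by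
    ext w
    simp only [A, gramDev, Set.mem_ofPred_eq]
    rw [iff_iff_eq]
    congr 1
    refine Finset.sum_congr rfl fun j _ => Finset.sum_congr rfl fun l _ => ?_
    rw [Finset.sum_coe_sort (T b) fun i => z j (ξ i w) * z l (ξ i w)
      - (1 : Matrix (Fin m) (Fin m) ℝ) j l]
  have := measure_biInter_blocks hind (fun i => (hid i).aemeasurable_fst) hT hA Finset.univ
  simp only [hEq] at this
  calc _ = P' (⋂ b ∈ Finset.univ, {w | (k : ℝ) ^ 2 / 4 < gramDev z (T b) fun i => ξ i w}) := by
        congr 1; ext w; simp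
    _ = _ := this
    _ ≤ ∏ _b : Fin q, ENNReal.ofReal (4 * m ^ 2 * η / k) := by
        gcongr with b _
        have hne : (T b).Nonempty := Finset.card_pos.1 (by rw [hTc]; exact hk)
        have := measure_gramDev_gt_le hind hid hξ₀ hz h4 h4' h1 hne
        rwa [hTc] at this
    _ = _ := by simp

theorem exists_disjoint_blocks (q n : ℕ) : ∃ T : Fin q → Finset (Fin n),
    (Pairwise fun b c => Disjoint (T b) (T c)) ∧ ∀ b, (T b).card = n / q := by
  rcases q.eq_zero_or_pos with rfl | hq
  · exact ⟨fun _ => ∅, fun b => b.elim0, fun b => b.elim0⟩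
  have hlt (b : Fin q) (i : Fin (n / q)) : (b : ℕ) * (n / q) + i < n := by
    calc (b : ℕ) * (n / q) + i < (b + 1) * (n / q) := by rw [add_one_mul]; omega
      _ ≤ q * (n / q) := Nat.mul_le_mul_right _ b.2
      _ ≤ n := Nat.mul_div_le n q
  refine ⟨fun b => Finset.univ.image fun i : Fin (n / q) => ⟨b * (n / q) + i, hlt b i⟩,
    fun b c hbc => ?_, fun b => ?_⟩
  · simp only
    rw [Finset.disjoint_left]
    simp only [Finset.mem_image, Finset.mem_univ, true_and, not_exists, forall_exists_index]
    rintro _ i rfl j hij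
    rw [Fin.mk.injEq] at hij
    apply hbc
    have hi := i.2
    have hj := j.2
    have h0 : 0 < n / q := by omega
    have e1 : ((b : ℕ) * (n / q) + i) / (n / q) = b := by
      rw [mul_comm, Nat.mul_add_div h0, Nat.div_eq_of_lt hi, add_zero]
    have e2 : ((c : ℕ) * (n / q) + j) / (n / q) = c := by
      rw [mul_comm, Nat.mul_add_div h0, Nat.div_eq_of_lt hj, add_zero]
    exact Fin.ext (by rw [← e1, ← e2, hij])
  · rw [Finset.card_image_of_injective, Finset.card_univ, Fintype.card_fin]
    intro i j hij
    simp only [Fin.mk.injEq] at hij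
    exact Fin.ext (by omega)

end IndependentCopies

/-! ### Compressed operators and inverse square roots -/

section CompressedOperator

variable {ψ : HilbertBasis ℕ ℝ L2I} {m : ℕ} {K : L2I →L[ℝ] L2I}

theorem opMatrix_mulVec (v : Fin m → ℝ) : opMatrix ψ m K *ᵥ v = coeffVec ψ m (K (synth ψ v)) := by
  ext i
  simp [opMatrix, coeffVec, synth, Matrix.mulVec, dotProduct, inner_sum, real_inner_smul_right,
    mul_comm]

theorem dotProduct_opMatrix_mulVec (v w : Fin m → ℝ) :
    v ⬝ᵥ opMatrix ψ m K *ᵥ w = ⟪synth ψ v, K (synth ψ w)⟫ := by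
  rw [opMatrix_mulVec, inner_synth]

theorem transpose_opMatrix (hK : ∀ f g, ⟪K f, g⟫ = ⟪f, K g⟫) :
    (opMatrix ψ m K)ᵀ = opMatrix ψ m K := by
  ext i j
  simp only [opMatrix, Matrix.transpose_apply, Matrix.of_apply]
  rw [real_inner_comm, hK]

theorem synth_eq_zero_iff {v : Fin m → ℝ} : synth ψ v = 0 ↔ v = 0 := by
  refine ⟨fun h => ?_, fun h => by simp [h, synth]⟩
  rw [← coeffVec_synth (ψ := ψ) v, h]
  ext; simp [coeffVec]

theorem posDef_opMatrix (hK : ∀ f g, ⟪K f, g⟫ = ⟪f, K g⟫) (hpos : ∀ f, f ≠ 0 → 0 < ⟪K f, f⟫) :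
    (opMatrix ψ m K).PosDef := by
  refine Matrix.PosDef.of_dotProduct_mulVec_pos ?_ fun v hv => ?_
  · rw [Matrix.IsHermitian, Matrix.conjTranspose_eq_transpose_of_trivial, transpose_opMatrix hK]
  · rw [star_trivial, dotProduct_opMatrix_mulVec, real_inner_comm]
    exact hpos _ fun h => hv (synth_eq_zero_iff.1 h)

variable {A : Matrix (Fin m) (Fin m) ℝ}

theorem transpose_invSqrt : (invSqrt A)ᵀ = invSqrt A := by
  have : IsSelfAdjoint (invSqrt A) := cfc_predicate _ _
  simpa [IsSelfAdjoint, Matrix.star_eq_conjTranspose] using this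

/-- On the positive spectrum the function `(√x)⁻¹ x (√x)⁻¹` is `1`; the spectrum is finite, so
continuity is automatic. -/
theorem invSqrt_mul_mul_invSqrt (hA : A.PosDef) : invSqrt A * A * invSqrt A = 1 := by
  have hsa : IsSelfAdjoint A := hA.isHermitian
  have hpos : ∀ x ∈ spectrum ℝ A, 0 < x := fun x hx => by
    rw [hA.isHermitian.spectrum_real_eq_range_eigenvalues] at hx
    obtain ⟨i, rfl⟩ := hx
    exact hA.eigenvalues_pos i
  have hcont (f : ℝ → ℝ) : ContinuousOn f (spectrum ℝ A) := by
    have : (spectrum ℝ A).Finite := by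
      rw [hA.isHermitian.spectrum_real_eq_range_eigenvalues]; exact Set.finite_range _
    exact this.continuousOn f
  have h1 : invSqrt A * A * invSqrt A = cfc (fun x : ℝ => (√x)⁻¹ * x * (√x)⁻¹) A := by
    rw [cfc_mul (fun x : ℝ => (√x)⁻¹ * x) (fun x : ℝ => (√x)⁻¹) A (hcont _) (hcont _),
      cfc_mul (fun x : ℝ => (√x)⁻¹) (fun x : ℝ => x) A (hcont _) (hcont _), cfc_id' ℝ A]
    rfl
  rw [h1, cfc_congr (g := fun _ => 1) fun x hx => ?_, cfc_const_one ℝ A]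
  have := hpos x hx
  have h2 : √x ≠ 0 := (Real.sqrt_pos.2 this).ne'
  have h3 : x = √x * √x := (Real.mul_self_sqrt this.le).symm
  simp only
  nth_rewrite 2 [h3]
  field_simp

/-- The isometric coordinates attached to the inverse square root: for `u = A^{1/2} v` one has
`v · x = u · A^{-1/2} x` and `|u|² = v · A v`. -/
theorem exists_invSqrt_coords (hA : A.PosDef) (v : Fin m → ℝ) :
    ∃ u : Fin m → ℝ, u ⬝ᵥ u = v ⬝ᵥ A *ᵥ v ∧ ∀ x, u ⬝ᵥ invSqrt A *ᵥ x = v ⬝ᵥ x := by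
  set R := invSqrt A with hR
  have h1 : R * A * R = 1 := invSqrt_mul_mul_invSqrt hA
  have h2 : R * (R * A) = 1 := mul_eq_one_comm.1 h1
  have h3 (x w : Fin m → ℝ) : x ⬝ᵥ R *ᵥ w = R *ᵥ x ⬝ᵥ w := by
    rw [Matrix.dotProduct_mulVec, ← Matrix.mulVec_transpose, transpose_invSqrt]
  have h4 : R *ᵥ (R * A) *ᵥ v = v := by rw [Matrix.mulVec_mulVec, h2, Matrix.one_mulVec]
  refine ⟨(R * A) *ᵥ v, ?_, fun x => ?_⟩
  · rw [← Matrix.mulVec_mulVec, h3, Matrix.mulVec_mulVec v R A, h4]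
  · rw [h3, h4]

end CompressedOperator

/-! ### Spectral norm of the inverse versus coercivity -/

section SpectralNorm

variable {m : ℕ} {A : Matrix (Fin m) (Fin m) ℝ}

theorem norm_toLp_sq (v : Fin m → ℝ) : ‖WithLp.toLp 2 v‖ ^ 2 = v ⬝ᵥ v := by
  rw [EuclideanSpace.norm_sq_eq]
  simp [dotProduct, sq]

theorem dotProduct_self_nonneg_real (v : Fin m → ℝ) : 0 ≤ v ⬝ᵥ v := by
  rw [← norm_toLp_sq]; positivity

theorem inner_toLp (v w : Fin m → ℝ) : ⟪WithLp.toLp 2 v, WithLp.toLp 2 w⟫ = v ⬝ᵥ w := by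
  rw [EuclideanSpace.inner_toLp_toLp, star_trivial, dotProduct_comm]

/-- A coercive matrix is invertible and its inverse is bounded. -/
theorem isUnit_and_specNorm_inv_le {κ : ℝ} (hκ : 0 < κ)
    (h : ∀ v : Fin m → ℝ, κ * (v ⬝ᵥ v) ≤ v ⬝ᵥ A *ᵥ v) : IsUnit A ∧ specNorm A⁻¹ ≤ κ⁻¹ := by
  have hU : IsUnit A := by
    rw [← Matrix.mulVec_injective_iff_isUnit]
    intro v w hvw
    have h1 := h (v - w)
    rw [Matrix.mulVec_sub, sub_eq_zero.2 hvw, dotProduct_zero] at h1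
    have h2 : (v - w) ⬝ᵥ (v - w) = 0 := by
      have := dotProduct_self_nonneg_real (v - w)
      nlinarith
    exact sub_eq_zero.1 (dotProduct_self_eq_zero.1 h2)
  refine ⟨hU, ?_⟩
  have hdet := (Matrix.isUnit_iff_isUnit_det A).1 hU
  refine ContinuousLinearMap.opNorm_le_bound _ (by positivity) fun x => ?_
  obtain ⟨w, rfl⟩ : ∃ w, x = WithLp.toLp 2 w := ⟨_, rfl⟩
  rw [Matrix.toEuclideanCLM_toLp]
  set v := A⁻¹ *ᵥ w with hv
  have hw : A *ᵥ v = w := by rw [hv, Matrix.mulVec_mulVec, Matrix.mul_nonsing_inv _ hdet,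
    Matrix.one_mulVec]
  have h1 := h v
  rw [hw, ← norm_toLp_sq, ← inner_toLp] at h1
  have h2 := real_inner_le_norm (WithLp.toLp 2 v) (WithLp.toLp 2 w)
  rcases (norm_nonneg (WithLp.toLp 2 v)).eq_or_lt with h0 | h0
  · rw [← h0]; positivity
  rw [inv_mul_eq_div, le_div_iff₀ hκ]
  refine le_of_mul_le_mul_right ?_ h0
  nlinarith

/-- A bound on the inverse of a positive semidefinite matrix is a lower bound on its form. -/
theorem dotProduct_self_le_of_specNorm_inv_le {γ : ℝ} (hγ : 0 < γ) (hA : IsUnit A)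
    (hAγ : specNorm A⁻¹ ≤ γ) (hs : Aᵀ = A) (h0 : ∀ v : Fin m → ℝ, 0 ≤ v ⬝ᵥ A *ᵥ v)
    (v : Fin m → ℝ) : v ⬝ᵥ v ≤ γ * (v ⬝ᵥ A *ᵥ v) := by
  have hdet := (Matrix.isUnit_iff_isUnit_det A).1 hA
  -- The inequality `T² ≤ γ T` for `T = A⁻¹`, evaluated at `A v`.
  have h1 := norm_sq_apply_le_of_inner_nonneg (T := Matrix.toEuclideanCLM (n := Fin m) (𝕜 := ℝ) A⁻¹)
    (fun x y => ?_) (fun x => ?_) hγ hAγ (WithLp.toLp 2 (A *ᵥ v))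
  · rwa [Matrix.toEuclideanCLM_toLp, Matrix.mulVec_mulVec, Matrix.nonsing_inv_mul _ hdet,
      Matrix.one_mulVec, norm_toLp_sq, inner_toLp] at h1
  · obtain ⟨x, rfl⟩ : ∃ w, x = WithLp.toLp 2 w := ⟨_, rfl⟩
    obtain ⟨y, rfl⟩ : ∃ w, y = WithLp.toLp 2 w := ⟨_, rfl⟩
    rw [Matrix.toEuclideanCLM_toLp, Matrix.toEuclideanCLM_toLp, inner_toLp, inner_toLp,
      Matrix.dotProduct_mulVec, ← Matrix.mulVec_transpose, Matrix.transpose_nonsing_inv, hs]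
  · obtain ⟨x, rfl⟩ : ∃ w, x = WithLp.toLp 2 w := ⟨_, rfl⟩
    rw [Matrix.toEuclideanCLM_toLp, inner_toLp]
    have := h0 (A⁻¹ *ᵥ x)
    rwa [Matrix.mulVec_mulVec, Matrix.mul_nonsing_inv _ hdet, Matrix.one_mulVec] at this

end SpectralNorm

/-! ### From Gram deviation to a lower bound on the form -/

section Gram

variable {α : Type*} {n m : ℕ} {z : Fin m → α → ℝ} {s : Finset (Fin n)} {x : Fin n → α}

/-- Cauchy–Schwarz over index pairs bounds the form of the deviation by `u ⬝ᵥ u` times its Frobenius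
norm, here at most half the cardinality. -/
theorem half_card_mul_le_of_gramDev_le (h : gramDev z s x ≤ (s.card : ℝ) ^ 2 / 4)
    (u : Fin m → ℝ) :
    (s.card : ℝ) / 2 * (u ⬝ᵥ u) ≤ ∑ i ∈ s, (u ⬝ᵥ fun j => z j (x i)) ^ 2 := by
  set D : Fin m → Fin m → ℝ := fun j k =>
    ∑ i ∈ s, (z j (x i) * z k (x i) - (1 : Matrix (Fin m) (Fin m) ℝ) j k) with hD
  set Q : ℝ := ∑ p : Fin m × Fin m, (u p.1 * u p.2) * D p.1 p.2 with hQ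
  have h1 : Q = ∑ i ∈ s, (u ⬝ᵥ fun j => z j (x i)) ^ 2 - s.card * (u ⬝ᵥ u) := by
    have e1 (i : Fin n) : (u ⬝ᵥ fun j => z j (x i)) ^ 2
        = ∑ j, ∑ k, u j * u k * (z j (x i) * z k (x i)) := by
      rw [sq, dotProduct, Finset.sum_mul_sum]
      exact Finset.sum_congr rfl fun j _ => Finset.sum_congr rfl fun k _ => by ring
    have e2 : u ⬝ᵥ u = ∑ j, ∑ k, u j * u k * (1 : Matrix (Fin m) (Fin m) ℝ) j k := by
      simp [Matrix.one_apply, dotProduct]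
    simp only [e1]
    rw [e2, hQ, Fintype.sum_prod_type, Finset.sum_comm (s := s), Finset.mul_sum,
      ← Finset.sum_sub_distrib]
    refine Finset.sum_congr rfl fun j _ => ?_
    rw [Finset.sum_comm (s := s), Finset.mul_sum, ← Finset.sum_sub_distrib]
    refine Finset.sum_congr rfl fun k _ => ?_
    rw [← Finset.mul_sum, hD]
    simp only [Finset.sum_sub_distrib, Finset.sum_const, nsmul_eq_mul]
    ring
  have h2 : Q ^ 2 ≤ (u ⬝ᵥ u) ^ 2 * ((s.card : ℝ) ^ 2 / 4) := by
    refine (Finset.sum_mul_sq_le_sq_mul_sq _ _ _).trans ?_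
    have e3 : ∑ p : Fin m × Fin m, (u p.1 * u p.2) ^ 2 = (u ⬝ᵥ u) ^ 2 := by
      rw [Fintype.sum_prod_type, sq (u ⬝ᵥ u), dotProduct, Finset.sum_mul_sum]
      exact Finset.sum_congr rfl fun j _ => Finset.sum_congr rfl fun k _ => by ring
    rw [e3, Fintype.sum_prod_type]
    exact mul_le_mul_of_nonneg_left h (sq_nonneg _)
  have h3 := abs_le_of_sq_le_sq' (show Q ^ 2 ≤ ((u ⬝ᵥ u) * (s.card / 2)) ^ 2 by linarith)
    (mul_nonneg (dotProduct_self_nonneg_real u) (by positivity))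
  linarith [h3.1]

end Gram

/-! ### Moments of the regressor and of the residual -/

section Population

theorem secondCountableTopology_L2I : SecondCountableTopology L2I := by
  have : Fact ((2 : ℝ≥0∞) ≠ ∞) := ⟨ENNReal.ofNat_ne_top⟩
  infer_instance

variable {Ω₀ : Type*} [MeasurableSpace Ω₀] {P₀ : Measure Ω₀}
  {ψ : HilbertBasis ℕ ℝ L2I} {υ : ℕ → ℝ} {d η σ : ℝ} {X : Ω₀ → L2I} {ε Y : Ω₀ → ℝ} {β : L2I}

theorem inner_covOp (hX : MemLp X 2 P₀) (f g : L2I) :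
    ⟪covOp X P₀ f, g⟫ = ∫ w, ⟪f, X w⟫ * ⟪g, X w⟫ ∂P₀ := by
  have := secondCountableTopology_L2I
  have hm := hX.aestronglyMeasurable.aemeasurable
  have hid : MemLp id 2 (P₀.map X) := by
    rw [memLp_map_measure_iff aestronglyMeasurable_id hm]; exact hX
  rw [covOp, covarianceOperator_inner hid, integral_map hm (by fun_prop)]

theorem norm_diagOp_basis_le (hυ : Summable υ) (h0 : ∀ j, 0 ≤ υ j) (j : ℕ) :
    ‖diagOp ψ υ (ψ j)‖ ≤ υ j := by
  have h := hasSum_le (fun k => ?_) (hasSum_inner_sq ψ (diagOp ψ υ (ψ j)))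
    ((hasSum_inner_sq ψ (ψ j)).mul_left (υ j ^ 2))
  · rw [ψ.orthonormal.1, one_pow, mul_one] at h
    exact le_of_sq_le_sq h (h0 j)
  · rw [inner_diagOp hυ, mul_pow]
    rcases eq_or_ne k j with rfl | hk
    · exact le_rfl
    · simp [ψ.orthonormal.2 hk]

theorem inner_covOp_basis_le (hυ : Summable υ) (h0 : ∀ j, 0 ≤ υ j) (hd : 1 ≤ d)
    (hlink : LinkClass ψ υ d (covOp X P₀)) (j : ℕ) :
    ⟪ψ j, covOp X P₀ (ψ j)⟫ ≤ d * υ j := by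
  calc _ ≤ ‖ψ j‖ * ‖covOp X P₀ (ψ j)‖ := real_inner_le_norm _ _
    _ = ‖covOp X P₀ (ψ j)‖ := by rw [ψ.orthonormal.1, one_mul]
    _ ≤ d * ‖diagOp ψ υ (ψ j)‖ := hlink.norm_apply_le hυ hd _
    _ ≤ _ := by gcongr; exact norm_diagOp_basis_le hυ h0 j

/-- The link condition bounds the variance of the coefficient by `d υ_j`; rescaling the standardized
moment gives the rest. -/
theorem integral_coeff_pow_four_le (hυ : Summable υ) (h0 : ∀ j, 0 ≤ υ j) (hd : 1 ≤ d)
    (hX : RegressorClass ψ 4 η X P₀) (hlink : LinkClass ψ υ d (covOp X P₀)) (j : ℕ) :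
    Integrable (fun w => ⟪ψ j, X w⟫ ^ 4) P₀ ∧
      ∫ w, ⟪ψ j, X w⟫ ^ 4 ∂P₀ ≤ η * d ^ 2 * υ j ^ 2 := by
  set g := ⟪ψ j, covOp X P₀ (ψ j)⟫ with hg
  have hg0 : 0 < g := by
    rw [hg, real_inner_comm]; exact hX.strictPos _ (ψ.orthonormal.ne_zero j)
  have e (w : Ω₀) : ⟪ψ j, X w⟫ ^ 4 = g ^ 2 * |⟪ψ j, X w⟫ / √g| ^ 4 := by
    have h4 : √g ^ 4 = g ^ 2 := by
      rw [show 4 = 2 * 2 from rfl, pow_mul, Real.sq_sqrt hg0.le]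
    rw [Even.pow_abs (by decide), div_pow, h4]
    field_simp
  obtain ⟨h1, h2⟩ := hX.coord_moment j
  simp only [e]
  refine ⟨h1.const_mul _, ?_⟩
  rw [integral_const_mul]
  have hg1 : g ≤ d * υ j := inner_covOp_basis_le hυ h0 hd hlink j
  calc g ^ 2 * _ ≤ (d * υ j) ^ 2 * η := by gcongr
    _ = _ := by ring

/-- Cauchy–Schwarz with weights `υ_j`, chosen because the fourth moments of the coefficients are of
order `υ_j²`: after division by `υ_j` they remain summable. -/
theorem ofReal_norm_pow_four_le (hυ : Summable υ) (h0 : ∀ j, 0 < υ j) (f : L2I) :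
    ENNReal.ofReal (‖f‖ ^ 4)
      ≤ ENNReal.ofReal (∑' j, υ j) * ∑' j, ENNReal.ofReal (⟪ψ j, f⟫ ^ 4 / υ j) := by
  have hlim : Tendsto (fun N => ENNReal.ofReal ((∑ j ∈ Finset.range N, ⟪ψ j, f⟫ ^ 2) ^ 2)) atTop
      (𝓝 (ENNReal.ofReal (‖f‖ ^ 4))) := by
    rw [show ‖f‖ ^ 4 = (‖f‖ ^ 2) ^ 2 by ring]
    exact ENNReal.tendsto_ofReal ((hasSum_inner_sq ψ f).tendsto_sum_nat.pow 2)
  refine le_of_tendsto' hlim fun N => ?_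
  have h1 : (∑ j ∈ Finset.range N, ⟪ψ j, f⟫ ^ 2) ^ 2
      ≤ (∑ j ∈ Finset.range N, υ j) * ∑ j ∈ Finset.range N, ⟪ψ j, f⟫ ^ 4 / υ j := by
    refine Finset.sum_sq_le_sum_mul_sum_of_sq_le_mul _ (fun j _ => (h0 j).le)
      (fun j _ => div_nonneg (by positivity) (h0 j).le) fun j _ => le_of_eq ?_
    have := (h0 j).ne'
    field_simp
  calc _ ≤ ENNReal.ofReal ((∑ j ∈ Finset.range N, υ j)
        * ∑ j ∈ Finset.range N, ⟪ψ j, f⟫ ^ 4 / υ j) := ENNReal.ofReal_le_ofReal h1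
    _ = ENNReal.ofReal (∑ j ∈ Finset.range N, υ j)
        * ∑ j ∈ Finset.range N, ENNReal.ofReal (⟪ψ j, f⟫ ^ 4 / υ j) := by
      rw [ENNReal.ofReal_mul (Finset.sum_nonneg fun j _ => (h0 j).le),
        ENNReal.ofReal_sum_of_nonneg fun j _ => div_nonneg (by positivity) (h0 j).le]
    _ ≤ _ := by
      gcongr
      · exact hυ.sum_le_tsum _ fun j _ => (h0 j).le
      · exact ENNReal.sum_le_tsum _

theorem integral_norm_pow_four_le (hυ : Summable υ) (h0 : ∀ j, 0 < υ j) (hd : 1 ≤ d) (hη : 1 ≤ η)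
    (hX : RegressorClass ψ 4 η X P₀) (hlink : LinkClass ψ υ d (covOp X P₀)) :
    Integrable (fun w => ‖X w‖ ^ 4) P₀ ∧
      ∫ w, ‖X w‖ ^ 4 ∂P₀ ≤ η * d ^ 2 * (∑' j, υ j) ^ 2 := by
  have hL : 0 ≤ ∑' j, υ j := tsum_nonneg fun j => (h0 j).le
  have hc (j : ℕ) := integral_coeff_pow_four_le hυ (fun j => (h0 j).le) hd hX hlink j
  have hle : ∫⁻ w, ENNReal.ofReal (‖X w‖ ^ 4) ∂P₀
      ≤ ENNReal.ofReal (η * d ^ 2 * (∑' j, υ j) ^ 2) := by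
    calc _ ≤ ∫⁻ w, ENNReal.ofReal (∑' j, υ j)
          * ∑' j, ENNReal.ofReal (⟪ψ j, X w⟫ ^ 4 / υ j) ∂P₀ :=
          lintegral_mono fun w => ofReal_norm_pow_four_le hυ h0 (X w)
      _ = ENNReal.ofReal (∑' j, υ j)
          * ∑' j, ∫⁻ w, ENNReal.ofReal (⟪ψ j, X w⟫ ^ 4 / υ j) ∂P₀ := by
        rw [lintegral_const_mul' _ _ ENNReal.ofReal_ne_top, lintegral_tsum fun j => ?_]
        exact ((hc j).1.aemeasurable.div_const _).ennreal_ofReal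
      _ ≤ ENNReal.ofReal (∑' j, υ j) * ∑' j, ENNReal.ofReal (η * d ^ 2 * υ j) := by
        gcongr with j
        rw [← ofReal_integral_eq_lintegral_ofReal ((hc j).1.div_const _)
          (Eventually.of_forall fun w => div_nonneg (by positivity) (h0 j).le), integral_div]
        refine ENNReal.ofReal_le_ofReal ?_
        rw [div_le_iff₀ (h0 j)]
        refine (hc j).2.trans (le_of_eq ?_)
        ring
      _ = _ := by
        rw [← ENNReal.ofReal_tsum_of_nonneg (fun j => ?_) (hυ.mul_left _), tsum_mul_left,
          ← ENNReal.ofReal_mul hL]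
        · congr 1; ring
        · have := h0 j
          positivity
  have hint : Integrable (fun w => ‖X w‖ ^ 4) P₀ := by
    refine ⟨hX.memLp.aestronglyMeasurable.norm.pow 4, ?_⟩
    rw [hasFiniteIntegral_iff_ofReal (Eventually.of_forall fun w => by positivity)]
    exact hle.trans_lt ENNReal.ofReal_lt_top
  refine ⟨hint, ?_⟩
  rw [← ofReal_integral_eq_lintegral_ofReal hint (Eventually.of_forall fun w => by positivity)] at hle
  exact (ENNReal.ofReal_le_ofReal_iff (by positivity)).1 hle

variable {m : ℕ}

/-- The `j`-th coordinate of `A^{-1/2} [x]_m` as a function of a data point `(y, x)`. -/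
noncomputable def stdCoord (ψ : HilbertBasis ℕ ℝ L2I) {m : ℕ} (A : Matrix (Fin m) (Fin m) ℝ)
    (j : Fin m) (p : ℝ × L2I) : ℝ :=
  (invSqrt A *ᵥ coeffVec ψ m p.2) j

theorem measurable_inner_snd (f : L2I) : Measurable fun p : ℝ × L2I => ⟪f, p.2⟫ :=
  (continuous_const.inner continuous_id).measurable.comp measurable_snd

theorem measurable_stdCoord (A : Matrix (Fin m) (Fin m) ℝ) (j : Fin m) :
    Measurable (stdCoord ψ A j) := by
  unfold stdCoord Matrix.mulVec dotProduct coeffVec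
  exact Finset.measurable_fun_sum _ fun i _ => (measurable_inner_snd (ψ i)).const_mul _

theorem stdCoord_eq_sum (A : Matrix (Fin m) (Fin m) ℝ) (j : Fin m) (p : ℝ × L2I) :
    stdCoord ψ A j p = ∑ i, invSqrt A j i * ⟪ψ i, p.2⟫ := rfl

theorem integral_stdCoord_mul (hX : RegressorClass ψ 4 η X P₀)
    (hΓ : ∀ f g, ⟪covOp X P₀ f, g⟫ = ⟪f, covOp X P₀ g⟫) (j k : Fin m) :
    ∫ w, stdCoord ψ (opMatrix ψ m (covOp X P₀)) j (Y w, X w)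
      * stdCoord ψ (opMatrix ψ m (covOp X P₀)) k (Y w, X w) ∂P₀
      = (1 : Matrix (Fin m) (Fin m) ℝ) j k := by
  set A := opMatrix ψ m (covOp X P₀) with hA
  have hint (a b : Fin m) : Integrable (fun w => ⟪ψ a, X w⟫ * ⟪ψ b, X w⟫) P₀ :=
    (hX.memLp.const_inner (ψ a)).integrable_mul (hX.memLp.const_inner (ψ b))
  have hAab (a b : Fin m) : A a b = ∫ w, ⟪ψ a, X w⟫ * ⟪ψ b, X w⟫ ∂P₀ := by
    rw [← inner_covOp hX.memLp, hΓ]; rfl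
  rw [← invSqrt_mul_mul_invSqrt (posDef_opMatrix hΓ hX.strictPos)]
  simp only [stdCoord_eq_sum, Finset.sum_mul_sum]
  have hint' (a b : Fin m) : Integrable (fun w => invSqrt A j a * ⟪ψ a, X w⟫
      * (invSqrt A k b * ⟪ψ b, X w⟫)) P₀ := by
    convert (hint a b).const_mul (invSqrt A j a * invSqrt A k b) using 2
    ring
  rw [integral_finsetSum _ fun a _ => integrable_finsetSum _ fun b _ => hint' a b]
  simp only [Matrix.mul_apply, Finset.sum_mul]
  rw [Finset.sum_comm]
  refine Finset.sum_congr rfl fun a _ => ?_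
  rw [integral_finsetSum _ fun b _ => hint' a b]
  refine Finset.sum_congr rfl fun b _ => ?_
  have e (w : Ω₀) : invSqrt A j a * ⟪ψ a, X w⟫ * (invSqrt A k b * ⟪ψ b, X w⟫)
      = invSqrt A j a * invSqrt A k b * (⟪ψ a, X w⟫ * ⟪ψ b, X w⟫) := by ring
  simp only [e]
  rw [integral_const_mul, ← hAab, ← congrFun (congrFun (transpose_invSqrt (A := A)) k) b,
    Matrix.transpose_apply]
  ring

/-- The residual `y - ⟨f, x⟩` of a data point `(y, x)`. -/
noncomputable def regResidual (f : L2I) (p : ℝ × L2I) : ℝ := p.1 - ⟪f, p.2⟫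

theorem measurable_residual (f : L2I) : Measurable (regResidual f) :=
  measurable_fst.sub (measurable_inner_snd f)

theorem residual_ae_eq (hmodel : LinearModel β σ X ε Y P₀) (f : L2I) :
    (fun w => regResidual f (Y w, X w)) =ᵐ[P₀] fun w => ⟪β - f, X w⟫ + σ * ε w := by
  filter_upwards [hmodel.model] with w hw
  simp only [regResidual, hw, inner_sub_left]
  ring

theorem aemeasurable_pair (hX : MemLp X 2 P₀) (hε : MemLp ε 2 P₀)
    (hmodel : LinearModel β σ X ε Y P₀) : AEMeasurable (fun w => (Y w, X w)) P₀ := by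
  have hY : AEMeasurable Y P₀ := by
    refine AEMeasurable.congr ?_ (EventuallyEq.symm hmodel.model)
    exact (hX.const_inner β).aemeasurable.add (hε.aemeasurable.const_mul σ)
  exact hY.prodMk hX.aestronglyMeasurable.aemeasurable

/-- The residual is `⟨β - f, X⟩ + σ ε` almost surely, and `(a + b)^4 ≤ 8 (a^4 + b^4)`. The bound
depends on `f` only through `‖β - f‖`. -/
theorem integral_residual_pow_four_le {C : ℝ} (hX : MemLp X 2 P₀)
    (hX4 : Integrable (fun w => ‖X w‖ ^ 4) P₀) (hX4' : ∫ w, ‖X w‖ ^ 4 ∂P₀ ≤ C)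
    (hε : ErrorClass 4 η ε P₀) (hmodel : LinearModel β σ X ε Y P₀) (f : L2I) :
    Integrable (fun w => regResidual f (Y w, X w) ^ 4) P₀ ∧
      ∫ w, regResidual f (Y w, X w) ^ 4 ∂P₀ ≤ 8 * (‖β - f‖ ^ 4 * C + σ ^ 4 * η) := by
  have hmeas := (measurable_residual f).comp_aemeasurable (aemeasurable_pair hX hε.memLp hmodel)
  have hdom : Integrable (fun w => 8 * (‖β - f‖ ^ 4 * ‖X w‖ ^ 4 + σ ^ 4 * |ε w| ^ 4)) P₀ :=
    ((hX4.const_mul _).add (hε.moment_integrable.const_mul _)).const_mul 8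
  have hle : ∀ᵐ w ∂P₀, regResidual f (Y w, X w) ^ 4
      ≤ 8 * (‖β - f‖ ^ 4 * ‖X w‖ ^ 4 + σ ^ 4 * |ε w| ^ 4) := by
    filter_upwards [residual_ae_eq hmodel f] with w hw
    rw [hw, ← mul_pow, Even.pow_abs (by decide), ← mul_pow]
    have h1 : ⟪β - f, X w⟫ ^ 4 ≤ (‖β - f‖ * ‖X w‖) ^ 4 := by
      rw [← Even.pow_abs (by decide) ⟪β - f, X w⟫]
      gcongr
      exact abs_real_inner_le_norm _ _
    generalize ⟪β - f, X w⟫ = a at *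
    generalize σ * ε w = b at *
    have h2 : (a + b) ^ 4 ≤ 8 * (a ^ 4 + b ^ 4) := by
      have h3 : (a + b) ^ 2 ≤ 2 * (a ^ 2 + b ^ 2) := by nlinarith [sq_nonneg (a - b)]
      calc (a + b) ^ 4 = ((a + b) ^ 2) ^ 2 := by ring
        _ ≤ (2 * (a ^ 2 + b ^ 2)) ^ 2 := by gcongr
        _ ≤ _ := by nlinarith [sq_nonneg (a ^ 2 - b ^ 2)]
    linarith
  have hint : Integrable (fun w => regResidual f (Y w, X w) ^ 4) P₀ := by
    refine hdom.mono' (hmeas.pow_const 4).aestronglyMeasurable ?_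
    filter_upwards [hle] with w hw
    rwa [Real.norm_of_nonneg (by positivity)]
  refine ⟨hint, (integral_mono_ae hint hdom hle).trans ?_⟩
  rw [integral_const_mul, integral_add (hX4.const_mul _) (hε.moment_integrable.const_mul _),
    integral_const_mul, integral_const_mul]
  have := hε.moment_le
  gcongr

/-- Only `E[ε X] = 0` is needed to remove the noise, not independence of `ε` and `X`. -/
theorem integral_residual_mul_inner (hX : MemLp X 2 P₀) (hε : MemLp ε 2 P₀)
    (hmodel : LinearModel β σ X ε Y P₀) (f g : L2I) :
    ∫ w, regResidual f (Y w, X w) * ⟪g, X w⟫ ∂P₀ = ⟪covOp X P₀ (β - f), g⟫ := by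
  have h1 : (fun w => regResidual f (Y w, X w) * ⟪g, X w⟫)
      =ᵐ[P₀] fun w => ⟪β - f, X w⟫ * ⟪g, X w⟫ + σ * ⟪g, ε w • X w⟫ := by
    filter_upwards [residual_ae_eq hmodel f] with w hw
    rw [hw, real_inner_smul_right]
    ring
  have i1 : Integrable (fun w => ⟪β - f, X w⟫ * ⟪g, X w⟫) P₀ :=
    (hX.const_inner _).integrable_mul (hX.const_inner _)
  have i2 : Integrable (fun w => ε w • X w) P₀ :=
    memLp_one_iff_integrable.1 (MemLp.smul (p := 2) (q := 2) hX hε)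
  rw [integral_congr_ae h1, integral_add i1 ((i2.const_inner g).const_mul σ), integral_const_mul,
    integral_inner i2, hmodel.uncorrelated, inner_zero_right, mul_zero, add_zero, inner_covOp hX]

end Population

/-! ### Scores and residuals of the sample -/

section Sample

variable {Ω' Ω₀ : Type*} [MeasurableSpace Ω'] [MeasurableSpace Ω₀] {n m : ℕ}
  {P' : Measure Ω'} {P₀ : Measure Ω₀} {ξ : Fin n → Ω' → ℝ × L2I}
  {ψ : HilbertBasis ℕ ℝ L2I} {η σ C : ℝ} {X : Ω₀ → L2I} {ε Y : Ω₀ → ℝ} {β f : L2I}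

theorem integrable_stdCoord_pow_four (hX : RegressorClass ψ 4 η X P₀) (j : Fin m) :
    Integrable (fun w => stdCoord ψ (opMatrix ψ m (covOp X P₀)) j (Y w, X w) ^ 4) P₀ ∧
      ∫ w, stdCoord ψ (opMatrix ψ m (covOp X P₀)) j (Y w, X w) ^ 4 ∂P₀ ≤ η := by
  have h := hX.standardized_moment m j
  simp only [Even.pow_abs (show Even 4 by decide)] at h
  exact h

/-- `∑_j (∑_i U_i Z_{ij})²` with the residuals `U_i` and the standardized coordinates `Z_{ij}`. -/
noncomputable def scoreSq (ψ : HilbertBasis ℕ ℝ L2I) {m : ℕ} (A : Matrix (Fin m) (Fin m) ℝ)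
    (f : L2I) (p : Fin n → ℝ × L2I) : ℝ :=
  ∑ j, (∑ i, regResidual f (p i) * stdCoord ψ A j (p i)) ^ 2

/-- The residual sum of squares. -/
noncomputable def residualSq (f : L2I) (p : Fin n → ℝ × L2I) : ℝ := ∑ i, regResidual f (p i) ^ 2

theorem scoreSq_nonneg (A : Matrix (Fin m) (Fin m) ℝ) (p : Fin n → ℝ × L2I) :
    0 ≤ scoreSq ψ A f p :=
  Finset.sum_nonneg fun _ _ => sq_nonneg _

theorem aemeasurable_scoreSq (hξ : ∀ i, AEMeasurable (ξ i) P') (A : Matrix (Fin m) (Fin m) ℝ) :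
    AEMeasurable (fun w => scoreSq ψ A f fun i => ξ i w) P' :=
  Finset.aemeasurable_fun_sum _ fun j _ => (Finset.aemeasurable_fun_sum _ fun i _ =>
    ((measurable_residual f).comp_aemeasurable (hξ i)).mul
      ((measurable_stdCoord A j).comp_aemeasurable (hξ i))).pow_const 2

theorem aemeasurable_residualSq (hξ : ∀ i, AEMeasurable (ξ i) P') :
    AEMeasurable (fun w => residualSq f fun i => ξ i w) P' :=
  Finset.aemeasurable_fun_sum _ fun i _ =>
    ((measurable_residual f).comp_aemeasurable (hξ i)).pow_const 2

theorem integrable_residual_mul_inner (hX : MemLp X 2 P₀) (hε : MemLp ε 2 P₀)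
    (hmodel : LinearModel β σ X ε Y P₀) (f g : L2I) :
    Integrable (fun w => regResidual f (Y w, X w) * ⟪g, X w⟫) P₀ := by
  have h1 : MemLp (fun w => ⟪β - f, X w⟫) 2 P₀ := hX.const_inner (β - f)
  have h2 : MemLp (fun w => σ * ε w) 2 P₀ := hε.const_mul σ
  have hU2 : MemLp (fun w => ⟪β - f, X w⟫ + σ * ε w) 2 P₀ := h1.add h2
  have h := hU2.integrable_mul (hX.const_inner (𝕜 := ℝ) g)
  refine h.congr ?_
  filter_upwards [residual_ae_eq hmodel f] with w hw
  rw [hw, Pi.mul_apply]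

/-- The residual contains the approximation error as well as the noise; the Galerkin equations make
that part orthogonal to the first `m` coordinates. -/
theorem integral_residual_mul_stdCoord
    (hX : RegressorClass ψ 4 η X P₀) (hε : MemLp ε 2 P₀) (hmodel : LinearModel β σ X ε Y P₀)
    (hf : ∀ i < m, ⟪covOp X P₀ (β - f), ψ i⟫ = 0) (A : Matrix (Fin m) (Fin m) ℝ) (j : Fin m) :
    ∫ w, regResidual f (Y w, X w) * stdCoord ψ A j (Y w, X w) ∂P₀ = 0 := by
  have e (w : Ω₀) : regResidual f (Y w, X w) * stdCoord ψ A j (Y w, X w)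
      = ∑ i : Fin m, invSqrt A j i * (regResidual f (Y w, X w) * ⟪ψ i, X w⟫) := by
    rw [stdCoord_eq_sum, Finset.mul_sum]
    exact Finset.sum_congr rfl fun i _ => by ring
  simp only [e]
  rw [integral_finsetSum _ fun (i : Fin m) _ =>
    (integrable_residual_mul_inner hX.memLp hε hmodel f (ψ i)).const_mul (invSqrt A j i)]
  refine Finset.sum_eq_zero fun i _ => ?_
  rw [integral_const_mul, integral_residual_mul_inner hX.memLp hε hmodel, hf i i.2, mul_zero]

/-- For each of the `m` coordinates a sum of `n` centred independent copies is squared, so the mean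
grows like `n m` rather than `n² m`. -/
theorem lintegral_scoreSq_le [IsProbabilityMeasure P'] (hind : iIndepFun ξ P')
    (hid : ∀ i, IdentDistrib (ξ i) (fun w => (Y w, X w)) P' P₀)
    (hX : RegressorClass ψ 4 η X P₀) (hε : MemLp ε 2 P₀) (hmodel : LinearModel β σ X ε Y P₀)
    (hf : ∀ i < m, ⟪covOp X P₀ (β - f), ψ i⟫ = 0)
    (h4 : Integrable (fun w => regResidual f (Y w, X w) ^ 4) P₀)
    (h4' : ∫ w, regResidual f (Y w, X w) ^ 4 ∂P₀ ≤ C) :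
    ∫⁻ w, ENNReal.ofReal (scoreSq ψ (opMatrix ψ m (covOp X P₀)) f fun i => ξ i w) ∂P'
      ≤ ENNReal.ofReal (n * (m * ((C + η) / 2))) := by
  set A := opMatrix ψ m (covOp X P₀)
  have hpair := aemeasurable_pair hX.memLp hε hmodel
  have hU := (measurable_residual f).comp_aemeasurable hpair
  have hz (j : Fin m) := (measurable_stdCoord (ψ := ψ) A j).comp_aemeasurable hpair
  have hz4 (j : Fin m) := integrable_stdCoord_pow_four (Y := Y) hX j
  have hterm (j : Fin m) : ∫⁻ w, ENNReal.ofReal ((∑ i, regResidual f (ξ i w)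
      * stdCoord ψ A j (ξ i w)) ^ 2) ∂P' ≤ ENNReal.ofReal (n * ((C + η) / 2)) := by
    rw [lintegral_sq_sum_copies hind hid (h := fun p => regResidual f p * stdCoord ψ A j p)
      ((measurable_residual f).mul (measurable_stdCoord A j))
      (memLp_two_mul_of_integrable_pow_four hU (hz j) h4 (hz4 j).1) ?_ Finset.univ,
      Finset.card_univ, Fintype.card_fin]
    · refine ENNReal.ofReal_le_ofReal ?_
      gcongr
      refine (integral_mul_sq_le hU (hz j) h4 (hz4 j).1).trans ?_
      have := (hz4 j).2
      simp only [Function.comp_apply]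
      linarith
    · exact integral_residual_mul_stdCoord hX hε hmodel hf A j
  have hξ (i : Fin n) := (hid i).aemeasurable_fst
  calc _ = ∫⁻ w, ∑ j, ENNReal.ofReal ((∑ i, regResidual f (ξ i w)
      * stdCoord ψ A j (ξ i w)) ^ 2) ∂P' := by
        simp only [scoreSq, ENNReal.ofReal_sum_of_nonneg fun _ _ => sq_nonneg _]
    _ = ∑ j, ∫⁻ w, ENNReal.ofReal ((∑ i, regResidual f (ξ i w)
      * stdCoord ψ A j (ξ i w)) ^ 2) ∂P' := by
        refine lintegral_finsetSum' _ fun j _ => AEMeasurable.ennreal_ofReal ?_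
        exact (Finset.aemeasurable_fun_sum _ fun i _ =>
          ((measurable_residual f).comp_aemeasurable (hξ i)).mul
            ((measurable_stdCoord A j).comp_aemeasurable (hξ i))).pow_const 2
    _ ≤ ∑ _j : Fin m, ENNReal.ofReal (n * ((C + η) / 2)) := by gcongr with j _; exact hterm j
    _ = _ := by
        rw [Finset.sum_const, Finset.card_univ, Fintype.card_fin, nsmul_eq_mul,
          ← ENNReal.ofReal_natCast, ← ENNReal.ofReal_mul (by positivity)]
        congr 1; ring

theorem lintegral_residualSq_sq_le
    (hid : ∀ i, IdentDistrib (ξ i) (fun w => (Y w, X w)) P' P₀)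
    (h4 : Integrable (fun w => regResidual f (Y w, X w) ^ 4) P₀)
    (h4' : ∫ w, regResidual f (Y w, X w) ^ 4 ∂P₀ ≤ C) :
    ∫⁻ w, ENNReal.ofReal ((residualSq f fun i => ξ i w) ^ 2) ∂P' ≤ ENNReal.ofReal (n ^ 2 * C) := by
  have hid' (i : Fin n) : IdentDistrib (fun w => regResidual f (ξ i w) ^ 4)
      (fun w => regResidual f (Y w, X w) ^ 4) P' P₀ :=
    (hid i).comp ((measurable_residual f).pow_const 4)
  have hint (i : Fin n) := (hid' i).symm.integrable_snd h4
  have hsum : Integrable (fun w => (n : ℝ) * ∑ i, regResidual f (ξ i w) ^ 4) P' :=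
    (integrable_finsetSum _ fun i _ => hint i).const_mul _
  calc _ ≤ ∫⁻ w, ENNReal.ofReal (n * ∑ i, regResidual f (ξ i w) ^ 4) ∂P' := by
        gcongr with w
        refine sq_sum_le_card_mul_sum_sq.trans (le_of_eq ?_)
        rw [Finset.card_univ, Fintype.card_fin]
        congr 1
        exact Finset.sum_congr rfl fun i _ => by ring
    _ = ENNReal.ofReal (∫ w, n * ∑ i, regResidual f (ξ i w) ^ 4 ∂P') := by
        rw [ofReal_integral_eq_lintegral_ofReal hsum]
        exact Eventually.of_forall fun w => by positivity
    _ ≤ _ := by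
        refine ENNReal.ofReal_le_ofReal ?_
        rw [integral_const_mul, integral_finsetSum _ fun i _ => hint i]
        simp only [(hid' _).integral_eq, Finset.sum_const, Finset.card_univ, Fintype.card_fin,
          nsmul_eq_mul]
        rw [sq, mul_assoc]
        gcongr

end Sample

/-! ### Deterministic error bounds for given data -/

section Estimator

variable {n m : ℕ} {ψ : HilbertBasis ℕ ℝ L2I} {υ : ℕ → ℝ} {d c γ : ℝ} {Γ : L2I →L[ℝ] L2I}
  {p : Fin n → ℝ × L2I}

theorem inner_empCov (x : Fin n → L2I) (f g : L2I) :
    ⟪f, empCov x g⟫ = (n : ℝ)⁻¹ * ∑ i, ⟪f, x i⟫ * ⟪g, x i⟫ := by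
  simp only [empCov, smul_apply, sum_apply, InnerProductSpace.rankOne_apply, real_inner_smul_right,
    inner_sum]
  congr 1
  exact Finset.sum_congr rfl fun i _ => by rw [real_inner_comm g, mul_comm]

theorem inner_empCross (y : Fin n → ℝ) (x : Fin n → L2I) (f : L2I) :
    ⟪f, empCross y x⟫ = (n : ℝ)⁻¹ * ∑ i, y i * ⟪f, x i⟫ := by
  simp [empCross, real_inner_smul_right, inner_sum]

theorem dotProduct_empCov_mulVec (x : Fin n → L2I) (v : Fin m → ℝ) :
    v ⬝ᵥ opMatrix ψ m (empCov x) *ᵥ v = (n : ℝ)⁻¹ * ∑ i, ⟪synth ψ v, x i⟫ ^ 2 := by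
  rw [dotProduct_opMatrix_mulVec, inner_empCov]
  simp only [sq]

theorem transpose_opMatrix_empCov (x : Fin n → L2I) :
    (opMatrix ψ m (empCov x))ᵀ = opMatrix ψ m (empCov x) :=
  transpose_opMatrix fun f g => by
    rw [inner_empCov, real_inner_comm, inner_empCov]
    simp only [mul_comm]

theorem half_card_mul_form_le {A : Matrix (Fin m) (Fin m) ℝ} (hA : A.PosDef) {s : Finset (Fin n)}
    (h : gramDev (stdCoord ψ A) s p ≤ (s.card : ℝ) ^ 2 / 4) (v : Fin m → ℝ) :
    (s.card : ℝ) / 2 * (v ⬝ᵥ A *ᵥ v) ≤ ∑ i ∈ s, ⟪synth ψ v, (p i).2⟫ ^ 2 := by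
  obtain ⟨u, hu, hux⟩ := exists_invSqrt_coords hA v
  have := half_card_mul_le_of_gramDev_le h u
  rw [hu] at this
  refine this.trans (le_of_eq (Finset.sum_congr rfl fun i _ => ?_))
  rw [inner_synth, ← hux]
  rfl

/-- Observations outside `s` add only squares to the empirical form, so one good block bounds it
below. -/
theorem card_div_mul_form_le {A : Matrix (Fin m) (Fin m) ℝ} (hA : A.PosDef) {s : Finset (Fin n)}
    (hn : 0 < n) (h : gramDev (stdCoord ψ A) s p ≤ (s.card : ℝ) ^ 2 / 4) (v : Fin m → ℝ) :
    (s.card : ℝ) / (2 * n) * (v ⬝ᵥ A *ᵥ v)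
      ≤ v ⬝ᵥ opMatrix ψ m (empCov fun i => (p i).2) *ᵥ v := by
  have hn' : (0 : ℝ) < n := by exact_mod_cast hn
  rw [dotProduct_empCov_mulVec]
  calc _ = (n : ℝ)⁻¹ * ((s.card : ℝ) / 2 * (v ⬝ᵥ A *ᵥ v)) := by field_simp
    _ ≤ (n : ℝ)⁻¹ * ∑ i ∈ s, ⟪synth ψ v, (p i).2⟫ ^ 2 := by
        gcongr; exact half_card_mul_form_le hA h v
    _ ≤ _ := by
        gcongr
        exact Finset.subset_univ s

theorem FunLinReg.LinkClass.mul_dotProduct_le_form (hlink : LinkClass ψ υ d Γ) (hυ : Summable υ)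
    (hd : 1 ≤ d) (hΓ : ∀ f, 0 ≤ ⟪Γ f, f⟫) (hc1 : ∀ j < m, c ≤ υ j) (v : Fin m → ℝ) :
    c * (v ⬝ᵥ v) ≤ d * (v ⬝ᵥ opMatrix ψ m Γ *ᵥ v) := by
  rw [dotProduct_opMatrix_mulVec, real_inner_comm, ← inner_synth_synth (ψ := ψ),
    real_inner_self_eq_norm_sq]
  refine (mul_norm_sq_le_inner_diagOp hυ hc1 fun i hi => ?_).trans
    (hlink.inner_diagOp_le hυ hd hΓ _)
  rw [inner_basis_synth, dif_neg (by omega)]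

/-- When the Gram matrix of the standardized sample is close to the identity, the threshold is not
exceeded. -/
theorem FunLinReg.LinkClass.isUnit_and_specNorm_inv_empCov_le (hlink : LinkClass ψ υ d Γ)
    (hυ : Summable υ) (hd : 1 ≤ d) (hpos : ∀ f, f ≠ 0 → 0 < ⟪Γ f, f⟫) (hc : 0 < c)
    (hc1 : ∀ j < m, c ≤ υ j) (hn : 0 < n)
    (h : gramDev (stdCoord ψ (opMatrix ψ m Γ)) Finset.univ p ≤ (n : ℝ) ^ 2 / 4) :
    IsUnit (opMatrix ψ m (empCov fun i => (p i).2)) ∧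
      specNorm (opMatrix ψ m (empCov fun i => (p i).2))⁻¹ ≤ 8 * d ^ 3 / c := by
  have hn' : (0 : ℝ) < n := by exact_mod_cast hn
  have hd0 : 0 < d := by linarith
  have hΓ (f : L2I) : 0 ≤ ⟪Γ f, f⟫ := by
    rcases eq_or_ne f 0 with rfl | hf
    · simp
    · exact (hpos f hf).le
  have hA := posDef_opMatrix (ψ := ψ) (m := m) hlink.inner_comm hpos
  have h1 := isUnit_and_specNorm_inv_le (A := opMatrix ψ m (empCov fun i => (p i).2))
    (κ := c / (2 * d)) (by positivity) fun v => ?_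
  · refine ⟨h1.1, h1.2.trans ?_⟩
    rw [inv_div]
    -- The Gram bound gives `2 d / c`, within the threshold because `d ≥ 1`.
    have h3 : d ≤ d ^ 3 := le_self_pow₀ hd (by norm_num)
    gcongr
    linarith
  · have h2 := card_div_mul_form_le (s := Finset.univ) hA hn (by simpa using h) v
    rw [Finset.card_univ, Fintype.card_fin] at h2
    refine le_trans ?_ h2
    have h3 := hlink.mul_dotProduct_le_form hυ hd hΓ hc1 v
    calc c / (2 * d) * (v ⬝ᵥ v) = (c * (v ⬝ᵥ v)) / (2 * d) := by ring
      _ ≤ (d * (v ⬝ᵥ opMatrix ψ m Γ *ᵥ v)) / (2 * d) := by gcongr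
      _ = _ := by field_simp

/-- The normal equations: `N v` is the vector of averages of the residuals times the regressor
coefficients. -/
theorem form_error_eq (f : Fin m → ℝ) {N : Matrix (Fin m) (Fin m) ℝ}
    (hN : N = opMatrix ψ m (empCov fun i => (p i).2)) (hU : IsUnit N) {v : Fin m → ℝ}
    (hv : v = N⁻¹ *ᵥ coeffVec ψ m (empCross (fun i => (p i).1) fun i => (p i).2) - f) :
    v ⬝ᵥ N *ᵥ v = (n : ℝ)⁻¹ * ∑ i, regResidual (synth ψ f) (p i) * ⟪synth ψ v, (p i).2⟫ := by
  have hdet := (Matrix.isUnit_iff_isUnit_det N).1 hU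
  have h1 : N *ᵥ v = coeffVec ψ m (empCross (fun i => (p i).1) fun i => (p i).2) - N *ᵥ f := by
    rw [hv, Matrix.mulVec_sub, Matrix.mulVec_mulVec, Matrix.mul_nonsing_inv _ hdet,
      Matrix.one_mulVec]
  rw [h1, dotProduct_sub, ← inner_synth, hN, dotProduct_opMatrix_mulVec, inner_empCross,
    inner_empCov, ← mul_sub, ← Finset.sum_sub_distrib]
  congr 1
  refine Finset.sum_congr rfl fun i _ => ?_
  rw [regResidual]
  ring

/-- Error bound where the empirical form dominates the population form. -/
theorem form_error_le_scoreSq {A N : Matrix (Fin m) (Fin m) ℝ} (hA : A.PosDef) {f v : Fin m → ℝ}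
    {κ : ℝ} (hκ : 0 < κ) (hκN : κ * (v ⬝ᵥ A *ᵥ v) ≤ v ⬝ᵥ N *ᵥ v)
    (hv : v ⬝ᵥ N *ᵥ v
      = (n : ℝ)⁻¹ * ∑ i, regResidual (synth ψ f) (p i) * ⟪synth ψ v, (p i).2⟫) :
    v ⬝ᵥ A *ᵥ v ≤ (κ⁻¹) ^ 2 * (((n : ℝ)⁻¹) ^ 2 * scoreSq ψ A (synth ψ f) p) := by
  obtain ⟨u, hu, hux⟩ := exists_invSqrt_coords hA v
  set q := v ⬝ᵥ A *ᵥ v with hq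
  have hq0 : 0 ≤ q := hu ▸ dotProduct_self_nonneg_real u
  have h1 : ∑ i, regResidual (synth ψ f) (p i) * ⟪synth ψ v, (p i).2⟫
      = ∑ j, u j * ∑ i, regResidual (synth ψ f) (p i) * stdCoord ψ A j (p i) := by
    have e (i : Fin n) : ⟪synth ψ v, (p i).2⟫ = ∑ j, u j * stdCoord ψ A j (p i) := by
      rw [inner_synth, ← hux]; rfl
    simp only [e, Finset.mul_sum]
    rw [Finset.sum_comm]
    refine Finset.sum_congr rfl fun j _ => Finset.sum_congr rfl fun i _ => ?_
    ring
  -- The right side is linear in `q`, so one factor `q` cancels afterwards.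
  have h2 : (κ * q) ^ 2 ≤ ((n : ℝ)⁻¹) ^ 2 * (q * scoreSq ψ A (synth ψ f) p) := by
    calc (κ * q) ^ 2 ≤ (v ⬝ᵥ N *ᵥ v) ^ 2 := by gcongr
      _ = ((n : ℝ)⁻¹) ^ 2 *
          (∑ j, u j * ∑ i, regResidual (synth ψ f) (p i) * stdCoord ψ A j (p i)) ^ 2 := by
        rw [hv, h1, mul_pow]
      _ ≤ _ := by
        gcongr
        refine (Finset.sum_mul_sq_le_sq_mul_sq _ _ _).trans (le_of_eq ?_)
        rw [← hu, scoreSq, dotProduct]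
        simp only [sq]
  rcases hq0.eq_or_lt with h0 | h0
  · rw [← h0]
    have := scoreSq_nonneg (ψ := ψ) (f := synth ψ f) A p
    positivity
  · refine le_of_mul_le_mul_left ?_ (show 0 < κ ^ 2 * q by positivity)
    calc κ ^ 2 * q * q = (κ * q) ^ 2 := by ring
      _ ≤ _ := h2
      _ = _ := by field_simp

/-- Error bound where the empirical inverse is merely bounded by the threshold. -/
theorem FunLinReg.LinkClass.form_error_le_residualSq (hlink : LinkClass ψ υ d Γ) (hυ : Summable υ)
    (h0 : ∀ j, 0 ≤ υ j) (h1 : ∀ j, υ j ≤ 1) (hd : 1 ≤ d) (hγ : 0 < γ) {f v : Fin m → ℝ}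
    {N : Matrix (Fin m) (Fin m) ℝ} (hN : N = opMatrix ψ m (empCov fun i => (p i).2))
    (hU : IsUnit N) (hNγ : specNorm N⁻¹ ≤ γ)
    (hv : v ⬝ᵥ N *ᵥ v
      = (n : ℝ)⁻¹ * ∑ i, regResidual (synth ψ f) (p i) * ⟪synth ψ v, (p i).2⟫) :
    v ⬝ᵥ opMatrix ψ m Γ *ᵥ v ≤ d * γ * ((n : ℝ)⁻¹ * residualSq (synth ψ f) p) := by
  have hN0 (v : Fin m → ℝ) : 0 ≤ v ⬝ᵥ N *ᵥ v := by
    rw [hN, dotProduct_empCov_mulVec]; positivity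
  have hNv : v ⬝ᵥ N *ᵥ v = (n : ℝ)⁻¹ * ∑ i, ⟪synth ψ v, (p i).2⟫ ^ 2 := by
    rw [hN, dotProduct_empCov_mulVec]
  have e1 : v ⬝ᵥ opMatrix ψ m Γ *ᵥ v ≤ d * (v ⬝ᵥ v) := by
    rw [dotProduct_opMatrix_mulVec, ← inner_synth_synth (ψ := ψ), real_inner_self_eq_norm_sq]
    calc _ ≤ ‖synth ψ v‖ * ‖Γ (synth ψ v)‖ := real_inner_le_norm _ _
      _ ≤ ‖synth ψ v‖ * (d * (1 * ‖synth ψ v‖)) := by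
        gcongr
        refine (hlink.norm_apply_le hυ hd _).trans ?_
        gcongr
        exact norm_diagOp_le_of_tail (m := 0) hυ h0 (fun j _ => h1 j) fun i hi => by omega
      _ = _ := by ring
  have e2 := dotProduct_self_le_of_specNorm_inv_le hγ hU hNγ
    (by rw [hN, transpose_opMatrix_empCov]) hN0 v
  have e3 : v ⬝ᵥ N *ᵥ v ≤ (n : ℝ)⁻¹ * residualSq (synth ψ f) p := by
    -- The inequality `2 a b ≤ a² + b²` for each observation; the empirical form that appears on the
    -- right is absorbed.
    have : 2 * (v ⬝ᵥ N *ᵥ v) ≤ (n : ℝ)⁻¹ * residualSq (synth ψ f) p + v ⬝ᵥ N *ᵥ v := by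
      nth_rewrite 1 [hv]
      rw [hNv, ← mul_add, residualSq, ← Finset.sum_add_distrib, mul_left_comm, Finset.mul_sum]
      gcongr with i _
      nlinarith [sq_nonneg (regResidual (synth ψ f) (p i) - ⟪synth ψ v, (p i).2⟫)]
    linarith
  calc _ ≤ d * (v ⬝ᵥ v) := e1
    _ ≤ d * (γ * (v ⬝ᵥ N *ᵥ v)) := by gcongr
    _ ≤ d * (γ * ((n : ℝ)⁻¹ * residualSq (synth ψ f) p)) := by gcongr
    _ = _ := by ring

/-- On the span, `ω ≤ s υ` reduces the `ω`-norm to the form of the diagonal operator, which is below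
`d Γ`. -/
theorem weightedNormSq_synth_le (hlink : LinkClass ψ υ d Γ) (hυ : Summable υ)
    (h0 : ∀ j, 0 ≤ υ j) (hd : 1 ≤ d) (hΓ : ∀ f, 0 ≤ ⟪Γ f, f⟫) {w : ℕ → ℝ} {s : ℝ} (hs : 0 ≤ s)
    (hw : ∀ j < m, w j ≤ s * υ j) (v : Fin m → ℝ) :
    weightedNormSq ψ w (synth ψ v) ≤ ENNReal.ofReal (s * d * (v ⬝ᵥ opMatrix ψ m Γ *ᵥ v)) := by
  have h1 : weightedNormSq ψ υ (synth ψ v)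
      = ENNReal.ofReal ⟪diagOp ψ υ (synth ψ v), synth ψ v⟫ := by
    have := hasSum_inner_diagOp (ψ := ψ) hυ (synth ψ v) (synth ψ v)
    rw [weightedNormSq, ← this.tsum_eq, ENNReal.ofReal_tsum_of_nonneg (fun j =>
      mul_nonneg (h0 j) (mul_self_nonneg _)) this.summable]
    simp only [sq]
  calc _ ≤ ENNReal.ofReal s * weightedNormSq ψ υ (synth ψ v) := by
        refine weightedNormSq_le_mul hs fun j => ?_
        rcases lt_or_ge j m with hj | hj
        · rw [← mul_assoc]; gcongr; exact hw j hj
        · rw [inner_basis_synth, dif_neg (by omega)]; simp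
    _ ≤ _ := by
        rw [h1, ← ENNReal.ofReal_mul hs, mul_assoc]
        gcongr
        rw [dotProduct_opMatrix_mulVec, real_inner_comm (Γ _)]
        exact hlink.inner_diagOp_le hυ hd hΓ _

theorem weightedNormSq_add_le {w : ℕ → ℝ} (hw : ∀ j, 0 ≤ w j) (f g : L2I) :
    weightedNormSq ψ w (f + g) ≤ 2 * weightedNormSq ψ w f + 2 * weightedNormSq ψ w g := by
  rw [weightedNormSq, weightedNormSq, weightedNormSq, ← ENNReal.tsum_mul_left,
    ← ENNReal.tsum_mul_left, ← ENNReal.tsum_add]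
  gcongr with j
  have := hw j
  have h2 (a : ℝ) : 2 * ENNReal.ofReal a = ENNReal.ofReal (2 * a) := by
    rw [ENNReal.ofReal_mul zero_le_two, ENNReal.ofReal_ofNat]
  rw [h2, h2, ← ENNReal.ofReal_add (by positivity) (by positivity)]
  refine ENNReal.ofReal_le_ofReal ?_
  rw [inner_add_right]
  nlinarith [mul_nonneg this (sq_nonneg (⟪ψ j, f⟫ - ⟪ψ j, g⟫))]

theorem weightedNormSq_neg (w : ℕ → ℝ) (f : L2I) :
    weightedNormSq ψ w (-f) = weightedNormSq ψ w f := by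
  simp [weightedNormSq]

end Estimator

/-! ### Risk bound for fixed sample size -/

section Risk

variable {n m : ℕ} {ψ : HilbertBasis ℕ ℝ L2I} {ω b υ : ℕ → ℝ} {d η σ : ℝ} {Γ : L2I →L[ℝ] L2I}
  {β : L2I}

/-- The coefficients of the Galerkin approximation of `β`. -/
noncomputable def galerkinCoeffs (ψ : HilbertBasis ℕ ℝ L2I) (m : ℕ) (Γ : L2I →L[ℝ] L2I) (β : L2I) :
    Fin m → ℝ :=
  (opMatrix ψ m Γ)⁻¹ *ᵥ coeffVec ψ m (Γ β)

theorem inner_basis_apply_galerkin (hA : (opMatrix ψ m Γ).PosDef) :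
    ∀ i < m, ⟪ψ i, Γ (synth ψ (galerkinCoeffs ψ m Γ β))⟫ = ⟪ψ i, Γ β⟫ := by
  intro i hi
  have h : coeffVec ψ m (Γ (synth ψ (galerkinCoeffs ψ m Γ β))) = coeffVec ψ m (Γ β) := by
    rw [← opMatrix_mulVec, galerkinCoeffs, Matrix.mulVec_mulVec,
      Matrix.mul_nonsing_inv _ ((Matrix.isUnit_iff_isUnit_det _).1 hA.isUnit), Matrix.one_mulVec]
  exact congrFun h ⟨i, hi⟩

theorem inner_basis_synth_eq_zero (v : Fin m → ℝ) : ∀ i, m ≤ i → ⟪ψ i, synth ψ v⟫ = 0 :=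
  fun i hi => by rw [inner_basis_synth, dif_neg (by omega)]

theorem weightedNormSq_galerkin_bias_le (hlink : LinkClass ψ υ d Γ) (hυ : Summable υ)
    (hυ0 : ∀ j, 0 < υ j) (hυa : Antitone υ) (hd : 1 ≤ d) (hpos : ∀ f, f ≠ 0 → 0 < ⟪Γ f, f⟫)
    {w : ℕ → ℝ} (hw : ∀ j, 0 < w j) (hwa : Antitone fun j => υ j ^ 2 / w j) (hm : 1 ≤ m) :
    weightedNormSq ψ w (synth ψ (galerkinCoeffs ψ m Γ β) - β)
      ≤ ENNReal.ofReal (1 + (d ^ 2 * (1 + d ^ 2)) ^ 2) *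
        weightedNormSq ψ w (β - basisProj ψ m β) := by
  have hΓ (f : L2I) : 0 ≤ ⟪Γ f, f⟫ := by
    rcases eq_or_ne f 0 with rfl | hf
    · simp
    · exact (hpos f hf).le
  have hw1 := hw (m - 1)
  have hυ1 := hυ0 (m - 1)
  have key {i j : ℕ} (hij : i ≤ j) : w i * υ j ^ 2 ≤ w j * υ i ^ 2 := by
    have := hwa hij
    simp only [div_le_div_iff₀ (hw j) (hw i)] at this
    linarith
  -- With indices from `0`, position `m - 1` is the last index of the head; `c` and `K` are read off
  -- there, and monotonicity orders head and tail around them.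
  refine hlink.weightedNormSq_galerkin_sub_le hυ (fun j => (hυ0 j).le) hd hΓ (c := υ (m - 1))
    (K := w (m - 1) / υ (m - 1) ^ 2)
    (fun j hj => hυa (by omega)) (fun j hj => hυa (by omega)) (by positivity) (fun j hj => ?_)
    (fun j hj => ?_) (inner_basis_synth_eq_zero _)
    (inner_basis_apply_galerkin (posDef_opMatrix hlink.inner_comm hpos))
  · rw [div_mul_eq_mul_div, le_div_iff₀ (by positivity)]
    exact key (by omega)
  · rw [div_mul_eq_mul_div, div_le_iff₀ (by positivity)]
    exact key (by omega)

/-- The bias bound with unit weights. It is uniform in `m`, hence so are the residual moments. -/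
theorem norm_sub_galerkin_sq_le (hlink : LinkClass ψ υ d Γ) (hυ : Summable υ)
    (hυ0 : ∀ j, 0 < υ j) (hυa : Antitone υ) (hd : 1 ≤ d) (hpos : ∀ f, f ≠ 0 → 0 < ⟪Γ f, f⟫)
    (hm : 1 ≤ m) :
    ‖β - synth ψ (galerkinCoeffs ψ m Γ β)‖ ^ 2
      ≤ (1 + (d ^ 2 * (1 + d ^ 2)) ^ 2) * (2 * ‖β‖) ^ 2 := by
  have h := weightedNormSq_galerkin_bias_le (β := β) hlink hυ hυ0 hυa hd hpos (w := fun _ => 1)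
    (fun _ => one_pos) (fun i j hij => ?_) hm
  · rw [weightedNormSq_one, weightedNormSq_one, ← ENNReal.ofReal_mul (by positivity),
      ENNReal.ofReal_le_ofReal_iff (by positivity), norm_sub_rev] at h
    refine h.trans ?_
    gcongr
    calc ‖β - basisProj ψ m β‖ ≤ ‖β‖ + ‖basisProj ψ m β‖ := norm_sub_le _ _
      _ ≤ ‖β‖ + ‖β‖ := by gcongr; exact norm_basisProj_le β
      _ = _ := by ring
  · simp only [div_one]
    have := hυ0 j
    gcongr
    exact hυa hij

-- The four terms are the bias, the loss when the estimator is zero, the score term when some block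
-- is good, and the threshold term when all five are bad. The outer factors `2` come from splitting
-- the error into bias and stochastic part.
open Classical in
theorem weightedNormSq_estimator_sub_le (hreg : RegularWeights ω b υ) (hlink : LinkClass ψ υ d Γ)
    (hd : 1 ≤ d) (hpos : ∀ f, f ≠ 0 → 0 < ⟪Γ f, f⟫) (hn : 5 ≤ n) (f : Fin m → ℝ)
    {s : ℝ} (hs : 0 ≤ s) (hω : ∀ j < m, ω j ≤ s * υ j) (p : Fin n → ℝ × L2I)
    {T : Fin 5 → Finset (Fin n)} (hT : ∀ a, (T a).card = n / 5) :
    weightedNormSq ψ ω (estimator ψ m (8 * d ^ 3 / υ (m - 1)) (fun i => (p i).1)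
        (fun i => (p i).2) - β)
      ≤ 2 * weightedNormSq ψ ω (synth ψ f - β)
        + (if (n : ℝ) ^ 2 / 4 < gramDev (stdCoord ψ (opMatrix ψ m Γ)) Finset.univ p
            then weightedNormSq ψ ω β else 0)
        + 2 * ENNReal.ofReal (s * d * (400 * (((n : ℝ)⁻¹) ^ 2
            * scoreSq ψ (opMatrix ψ m Γ) (synth ψ f) p)))
        + (if ∀ a, ((n / 5 : ℕ) : ℝ) ^ 2 / 4 < gramDev (stdCoord ψ (opMatrix ψ m Γ)) (T a) p
            then 2 * ENNReal.ofReal (s * d * (d * (8 * d ^ 3 / υ (m - 1))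
              * ((n : ℝ)⁻¹ * residualSq (synth ψ f) p))) else 0) := by
  set A := opMatrix ψ m Γ with hAdef
  set N := opMatrix ψ m (empCov fun i => (p i).2) with hN
  have hA : A.PosDef := posDef_opMatrix hlink.inner_comm hpos
  have hΓ (f : L2I) : 0 ≤ ⟪Γ f, f⟫ := by
    rcases eq_or_ne f 0 with rfl | hf
    · simp
    · exact (hpos f hf).le
  have hυ := hreg.upsilon_summable
  have hυ0 (j : ℕ) : 0 ≤ υ j := (hreg.upsilon_pos j).le
  have hυ1 (j : ℕ) : υ j ≤ 1 := hreg.upsilon_one ▸ hreg.upsilon_anti (Nat.zero_le j)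
  have hc := hreg.upsilon_pos (m - 1)
  have hγ : 0 < 8 * d ^ 3 / υ (m - 1) := by positivity
  by_cases hE : IsUnit N ∧ specNorm N⁻¹ ≤ 8 * d ^ 3 / υ (m - 1)
  · set v := N⁻¹ *ᵥ coeffVec ψ m (empCross (fun i => (p i).1) fun i => (p i).2) - f with hv
    have hest : estimator ψ m (8 * d ^ 3 / υ (m - 1)) (fun i => (p i).1) (fun i => (p i).2) - β
        = synth ψ v + (synth ψ f - β) := by
      rw [estimator, if_pos hE, hv, synth_sub, synth]
      abel
    have hform := form_error_eq f hN hE.1 hv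
    have hsynth := weightedNormSq_synth_le hlink hυ hυ0 hd hΓ hs hω v
    have hmain : 2 * weightedNormSq ψ ω (synth ψ v)
        ≤ 2 * ENNReal.ofReal (s * d * (400 * (((n : ℝ)⁻¹) ^ 2 * scoreSq ψ A (synth ψ f) p)))
        + (if ∀ a, ((n / 5 : ℕ) : ℝ) ^ 2 / 4 < gramDev (stdCoord ψ A) (T a) p
            then 2 * ENNReal.ofReal (s * d * (d * (8 * d ^ 3 / υ (m - 1))
              * ((n : ℝ)⁻¹ * residualSq (synth ψ f) p))) else 0) := by
      split_ifs with hB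
      · refine le_add_left ?_
        gcongr
        refine hsynth.trans (ENNReal.ofReal_le_ofReal ?_)
        gcongr
        exact hlink.form_error_le_residualSq hυ hυ0 hυ1 hd hγ hN hE.1 hE.2 hform
      · rw [add_zero]
        gcongr
        refine hsynth.trans (ENNReal.ofReal_le_ofReal ?_)
        gcongr
        push Not at hB
        obtain ⟨a, ha⟩ := hB
        rw [← hT a] at ha
        have hq : 0 ≤ v ⬝ᵥ A *ᵥ v := by
          obtain ⟨u, hu, -⟩ := exists_invSqrt_coords hA v
          exact hu ▸ dotProduct_self_nonneg_real u
        have h1 := card_div_mul_form_le hA (by omega) ha v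
        rw [hT a] at h1
        -- Rounding down costs at most a factor two once `n ≥ 5`, so a block has at least `n / 10`
        -- observations. The square of `20` is the `400` above.
        have hk : (1 : ℝ) / 20 ≤ ((n / 5 : ℕ) : ℝ) / (2 * n) := by
          have hn' : (0 : ℝ) < n := by exact_mod_cast (by omega : 0 < n)
          rw [div_le_div_iff₀ (by norm_num) (by positivity)]
          have : n ≤ 10 * (n / 5) := by omega
          have : (n : ℝ) ≤ 10 * ((n / 5 : ℕ) : ℝ) := by exact_mod_cast this
          linarith
        have h2 := form_error_le_scoreSq hA (κ := 1 / 20) (by norm_num)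
          ((mul_le_mul_of_nonneg_right hk hq).trans h1) hform
        norm_num at h2 ⊢
        exact h2
    rw [hest]
    refine (weightedNormSq_add_le (fun j => (hreg.omega_pos j).le) _ _).trans ?_
    calc _ ≤ (2 * ENNReal.ofReal (s * d * (400 * (((n : ℝ)⁻¹) ^ 2 * scoreSq ψ A (synth ψ f) p)))
        + (if ∀ a, ((n / 5 : ℕ) : ℝ) ^ 2 / 4 < gramDev (stdCoord ψ A) (T a) p
            then 2 * ENNReal.ofReal (s * d * (d * (8 * d ^ 3 / υ (m - 1))
              * ((n : ℝ)⁻¹ * residualSq (synth ψ f) p))) else 0))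
          + 2 * weightedNormSq ψ ω (synth ψ f - β) := by gcongr
      _ = 2 * weightedNormSq ψ ω (synth ψ f - β) + 0
          + 2 * ENNReal.ofReal (s * d * (400 * (((n : ℝ)⁻¹) ^ 2 * scoreSq ψ A (synth ψ f) p)))
          + (if ∀ a, ((n / 5 : ℕ) : ℝ) ^ 2 / 4 < gramDev (stdCoord ψ A) (T a) p
            then 2 * ENNReal.ofReal (s * d * (d * (8 * d ^ 3 / υ (m - 1))
              * ((n : ℝ)⁻¹ * residualSq (synth ψ f) p))) else 0) := by ring
      _ ≤ _ := by gcongr; exact zero_le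
  · have hB0 : (n : ℝ) ^ 2 / 4 < gramDev (stdCoord ψ A) Finset.univ p := by
      by_contra! hB0
      exact hE (hlink.isUnit_and_specNorm_inv_empCov_le hυ hd hpos hc
        (fun j hj => hreg.upsilon_anti (by omega)) (by omega) hB0)
    rw [estimator, if_neg hE, zero_sub, weightedNormSq_neg, if_pos hB0, add_assoc, add_right_comm]
    exact le_add_self

variable {Ω' Ω₀ : Type*} [MeasurableSpace Ω'] [MeasurableSpace Ω₀]
  {P' : Measure Ω'} {P₀ : Measure Ω₀} {X : Ω₀ → L2I} {ε Y : Ω₀ → ℝ}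

theorem lintegral_estimator_sub_le [IsProbabilityMeasure P'] [IsProbabilityMeasure P₀]
    {C : ℝ} {Ys : Fin n → Ω' → ℝ} {Xs : Fin n → Ω' → L2I}
    (hreg : RegularWeights ω b υ) (hlink : LinkClass ψ υ d (covOp X P₀))
    (hd : 1 ≤ d) (hη : 1 ≤ η) (hn : 5 ≤ n) (hm : 1 ≤ m) (hC : 0 ≤ C)
    (hX : RegressorClass ψ 4 η X P₀) (hε : MemLp ε 2 P₀) (hmodel : LinearModel β σ X ε Y P₀)
    (hsample : IsSample Ys Xs P' Y X P₀) {f : Fin m → ℝ}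
    (hf : ∀ i < m, ⟪covOp X P₀ (β - synth ψ f), ψ i⟫ = 0)
    (h4 : Integrable (fun w => regResidual (synth ψ f) (Y w, X w) ^ 4) P₀)
    (h4' : ∫ w, regResidual (synth ψ f) (Y w, X w) ^ 4 ∂P₀ ≤ C)
    {s : ℝ} (hs : 0 ≤ s) (hω : ∀ j < m, ω j ≤ s * υ j) :
    ∫⁻ w, weightedNormSq ψ ω (estimator ψ m (8 * d ^ 3 / υ (m - 1)) (fun i => Ys i w)
        (fun i => Xs i w) - β) ∂P'
      ≤ 2 * weightedNormSq ψ ω (synth ψ f - β)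
        + weightedNormSq ψ ω β * ENNReal.ofReal (4 * m ^ 2 * η / n)
        + 2 * ENNReal.ofReal (200 * d * (C + η) * (m / n * s))
        + 2 * ENNReal.ofReal (4 * d ^ 5 * (C + 1) *
          (s * ((υ (m - 1))⁻¹ * √((4 * m ^ 2 * η / (n / 5 : ℕ)) ^ 5)))) := by
  classical
  obtain ⟨T, hTd, hT⟩ := exists_disjoint_blocks 5 n
  set A := opMatrix ψ m (covOp X P₀) with hAdef
  set ξ : Fin n → Ω' → ℝ × L2I := fun i w => (Ys i w, Xs i w) with hξdef
  have hind : iIndepFun ξ P' := hsample.indep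
  have hid : ∀ i, IdentDistrib (ξ i) (fun w => (Y w, X w)) P' P₀ := hsample.identDistrib
  have hξ (i : Fin n) : AEMeasurable (ξ i) P' := (hid i).aemeasurable_fst
  have hpair := aemeasurable_pair hX.memLp hε hmodel
  have hn0 : (0 : ℝ) < n := by exact_mod_cast (by omega : 0 < n)
  have hm0 : (0 : ℝ) < m := by exact_mod_cast hm
  have hk0 : (0 : ℝ) < (n / 5 : ℕ) := by exact_mod_cast (by omega : 0 < n / 5)
  have hη0 : 0 < η := by linarith
  have hd0 : 0 < d := by linarith
  have hυm := hreg.upsilon_pos (m - 1)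
  set B₀ := {w | (n : ℝ) ^ 2 / 4 < gramDev (stdCoord ψ A) Finset.univ fun i => ξ i w} with hB₀
  set B := {w | ∀ a, ((n / 5 : ℕ) : ℝ) ^ 2 / 4 < gramDev (stdCoord ψ A) (T a) fun i => ξ i w}
    with hB
  have hPB₀ : P' B₀ ≤ ENNReal.ofReal (4 * m ^ 2 * η / n) := by
    have := measure_gramDev_gt_le hind hid hpair (measurable_stdCoord (ψ := ψ) A)
      (fun j => (integrable_stdCoord_pow_four hX j).1)
      (fun j => (integrable_stdCoord_pow_four hX j).2)
      (integral_stdCoord_mul hX hlink.inner_comm) (s := Finset.univ)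
      ⟨⟨0, by omega⟩, Finset.mem_univ _⟩
    simpa using this
  set Q : ℝ := (4 * m ^ 2 * η / (n / 5 : ℕ)) ^ 5 with hQ
  have hQ0 : 0 < Q := by positivity
  have hPB : P' B ≤ ENNReal.ofReal Q := by
    rw [hQ, ENNReal.ofReal_pow (by positivity)]
    exact measure_gramDev_gt_blocks_le hind hid hpair (measurable_stdCoord (ψ := ψ) A)
      (fun j => (integrable_stdCoord_pow_four hX j).1)
      (fun j => (integrable_stdCoord_pow_four hX j).2)
      (integral_stdCoord_mul hX hlink.inner_comm) (by omega) hTd hT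
  -- Cauchy–Schwarz for the residual sum of squares `R` on the bad event is replaced by `R ≤ θ R² /
  -- 2 + 1 / (2 θ)`. As `E R² ≤ n² C` and the event has probability at most `Q`, this `θ` makes both
  -- contributions of order `n √Q`.
  set θ : ℝ := √Q / n with hθ
  have hsQ : 0 < √Q := Real.sqrt_pos.2 hQ0
  have hθ0 : 0 < θ := by positivity
  set c₁ : ℝ := s * d * (400 * ((n : ℝ)⁻¹) ^ 2) with hc₁
  set c₂ : ℝ := s * d * (d * (8 * d ^ 3 / υ (m - 1)) * (n : ℝ)⁻¹) with hc₂
  have hc₁0 : 0 ≤ c₁ := by positivity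
  have hc₂0 : 0 ≤ c₂ := by positivity
  let F₁ : Ω' → ℝ≥0∞ := fun _ => 2 * weightedNormSq ψ ω (synth ψ f - β)
  -- The data are only almost everywhere measurable, so the bad event is replaced by a measurable
  -- hull of the same measure.
  let F₂ : Ω' → ℝ≥0∞ := (toMeasurable P' B₀).indicator fun _ => weightedNormSq ψ ω β
  let F₃ : Ω' → ℝ≥0∞ := fun w => 2 * ENNReal.ofReal c₁ *
    ENNReal.ofReal (scoreSq ψ A (synth ψ f) fun i => ξ i w)
  let F₄ : Ω' → ℝ≥0∞ := fun w => 2 * ENNReal.ofReal (c₂ * (θ / 2)) *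
    ENNReal.ofReal ((residualSq (synth ψ f) fun i => ξ i w) ^ 2)
  let F₅ : Ω' → ℝ≥0∞ := (toMeasurable P' B).indicator fun _ =>
    2 * ENNReal.ofReal (c₂ * (1 / (2 * θ)))
  have hF₁ : AEMeasurable F₁ P' := aemeasurable_const
  have hF₂ : AEMeasurable F₂ P' :=
    aemeasurable_const.indicator (measurableSet_toMeasurable P' B₀)
  have hF₃ : AEMeasurable F₃ P' := (aemeasurable_scoreSq hξ A).ennreal_ofReal.const_mul _
  have hF₄ : AEMeasurable F₄ P' :=
    ((aemeasurable_residualSq hξ).pow_const 2).ennreal_ofReal.const_mul _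
  have hpt (w : Ω') : weightedNormSq ψ ω (estimator ψ m (8 * d ^ 3 / υ (m - 1)) (fun i => Ys i w)
      (fun i => Xs i w) - β) ≤ F₁ w + F₂ w + F₃ w + (F₄ w + F₅ w) := by
    refine (weightedNormSq_estimator_sub_le hreg hlink hd hX.strictPos hn f hs hω
      (fun i => ξ i w) hT).trans ?_
    gcongr ?_ + ?_ + ?_ + ?_
    · exact le_rfl
    · split_ifs with h
      · have hmem : w ∈ toMeasurable P' B₀ := subset_toMeasurable P' B₀ h
        exact (Set.indicator_of_mem hmem (f := fun _ => weightedNormSq ψ ω β)).ge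
      · exact zero_le
    · simp only [F₃]
      rw [mul_assoc 2 (ENNReal.ofReal c₁), ← ENNReal.ofReal_mul hc₁0, hc₁]
      refine le_of_eq ?_
      congr 2
      ring
    · split_ifs with h
      · have hmem : w ∈ toMeasurable P' B := subset_toMeasurable P' B h
        have e5 : F₅ w = 2 * ENNReal.ofReal (c₂ * (1 / (2 * θ))) := Set.indicator_of_mem hmem _
        rw [e5]
        simp only [F₄]
        rw [mul_assoc 2 (ENNReal.ofReal (c₂ * (θ / 2))), ← ENNReal.ofReal_mul (by positivity),
          ← mul_add,
          ← ENNReal.ofReal_add (by positivity) (by positivity)]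
        gcongr
        set R := residualSq (synth ψ f) fun i => ξ i w
        have h1 : R ≤ θ / 2 * R ^ 2 + 1 / (2 * θ) := by
          rw [← sub_nonneg]
          have : θ / 2 * R ^ 2 + 1 / (2 * θ) - R = (θ * R - 1) ^ 2 / (2 * θ) := by
            field_simp
            ring
          rw [this]
          positivity
        calc _ = c₂ * R := by rw [hc₂]; ring
          _ ≤ c₂ * (θ / 2 * R ^ 2 + 1 / (2 * θ)) := by gcongr
          _ = _ := by ring
      · exact zero_le
  have hI₂ : ∫⁻ w, F₂ w ∂P' ≤ weightedNormSq ψ ω β * ENNReal.ofReal (4 * m ^ 2 * η / n) := by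
    rw [lintegral_indicator_const (measurableSet_toMeasurable P' B₀), measure_toMeasurable]
    gcongr
  have hI₃ : ∫⁻ w, F₃ w ∂P' ≤ 2 * ENNReal.ofReal (200 * d * (C + η) * (m / n * s)) := by
    rw [lintegral_const_mul' _ _ (ENNReal.mul_ne_top ENNReal.ofNat_ne_top ENNReal.ofReal_ne_top),
      mul_assoc]
    gcongr
    calc _ ≤ ENNReal.ofReal c₁ * ENNReal.ofReal (n * (m * ((C + η) / 2))) := by
          gcongr
          exact lintegral_scoreSq_le hind hid hX hε hmodel hf h4 h4'
      _ = _ := by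
          rw [← ENNReal.ofReal_mul hc₁0, hc₁]
          congr 1
          field_simp
          ring
  have hI₄ : ∫⁻ w, F₄ w ∂P' ≤ 2 * ENNReal.ofReal (4 * d ^ 5 * C *
      (s * ((υ (m - 1))⁻¹ * √Q))) := by
    rw [lintegral_const_mul' _ _ (ENNReal.mul_ne_top ENNReal.ofNat_ne_top ENNReal.ofReal_ne_top),
      mul_assoc]
    gcongr
    calc _ ≤ ENNReal.ofReal (c₂ * (θ / 2)) * ENNReal.ofReal (n ^ 2 * C) := by
          gcongr
          exact lintegral_residualSq_sq_le hid h4 h4'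
      _ = _ := by
          rw [← ENNReal.ofReal_mul (by positivity), hc₂, hθ]
          congr 1
          field_simp
          ring
  have hI₅ : ∫⁻ w, F₅ w ∂P' ≤ 2 * ENNReal.ofReal (4 * d ^ 5 *
      (s * ((υ (m - 1))⁻¹ * √Q))) := by
    rw [lintegral_indicator_const (measurableSet_toMeasurable P' B), measure_toMeasurable,
      mul_assoc]
    gcongr
    calc _ ≤ ENNReal.ofReal (c₂ * (1 / (2 * θ))) * ENNReal.ofReal Q := by gcongr
      _ = _ := by
          rw [← ENNReal.ofReal_mul (by positivity), hc₂, hθ]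
          congr 1
          have : Q = √Q * √Q := (Real.mul_self_sqrt hQ0.le).symm
          generalize √Q = r at *
          rw [this]
          field_simp
          ring
  calc _ ≤ ∫⁻ w, (F₁ w + F₂ w + F₃ w + (F₄ w + F₅ w)) ∂P' := lintegral_mono hpt
    _ = ∫⁻ w, F₁ w ∂P' + ∫⁻ w, F₂ w ∂P' + ∫⁻ w, F₃ w ∂P'
        + (∫⁻ w, F₄ w ∂P' + ∫⁻ w, F₅ w ∂P') := by
      have h12 : AEMeasurable (fun w => F₁ w + F₂ w) P' := hF₁.add hF₂
      have h123 : AEMeasurable (fun w => F₁ w + F₂ w + F₃ w) P' := h12.add hF₃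
      rw [lintegral_add_left' h123, lintegral_add_left' h12, lintegral_add_left' hF₁,
        lintegral_add_left' hF₄]
    _ ≤ 2 * weightedNormSq ψ ω (synth ψ f - β)
        + weightedNormSq ψ ω β * ENNReal.ofReal (4 * m ^ 2 * η / n)
        + 2 * ENNReal.ofReal (200 * d * (C + η) * (m / n * s))
        + (2 * ENNReal.ofReal (4 * d ^ 5 * C * (s * ((υ (m - 1))⁻¹ * √Q)))
          + 2 * ENNReal.ofReal (4 * d ^ 5 * (s * ((υ (m - 1))⁻¹ * √Q)))) := by
      gcongr
      simp [F₁]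
    _ = _ := by
      rw [← mul_add, ← ENNReal.ofReal_add (by positivity) (by positivity)]
      congr 3
      ring

end Risk

/-! ### Asymptotic comparison of the rates -/

section Consistency

variable {ψ : HilbertBasis ℕ ℝ L2I} {ω b υ : ℕ → ℝ}

/-- As `b / ω` is non-decreasing and starts at `1`, one has `ω ≤ b`. -/
theorem FunLinReg.RegularWeights.weightedNormSq_ne_top (hreg : RegularWeights ω b υ) {β : L2I}
    (hβ : β ∈ sobolevClass ψ b) : weightedNormSq ψ ω β ≠ ∞ := by
  simp only [sobolevClass, Set.mem_iUnion, exists_prop] at hβ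
  obtain ⟨ρ, -, hρ⟩ := hβ
  have hωb (j : ℕ) : ω j ≤ b j := by
    have := hreg.b_div_omega_mono (Nat.zero_le j)
    simp only [hreg.omega_one, hreg.b_one, div_one] at this
    rwa [one_le_div₀ (hreg.omega_pos j)] at this
  refine ne_top_of_le_ne_top ENNReal.ofReal_ne_top (le_trans ?_ hρ)
  unfold weightedNormSq
  gcongr with j
  exact hωb j

theorem mul_le_tsum_of_antitone {υ : ℕ → ℝ} (hυ : Summable υ) (h0 : ∀ j, 0 < υ j)
    (ha : Antitone υ) {m : ℕ} (hm : 1 ≤ m) : m * υ (m - 1) ≤ ∑' j, υ j := by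
  calc (m : ℝ) * υ (m - 1) = ∑ _j ∈ Finset.range m, υ (m - 1) := by simp
    _ ≤ ∑ j ∈ Finset.range m, υ j := by
        gcongr with j hj
        exact ha (by have := Finset.mem_range.1 hj; omega)
    _ ≤ _ := hυ.sum_le_tsum _ fun j _ => (h0 j).le

/-- Write `M^10 = M² · M³ · M^5`. The growth condition bounds `M³` by `B u² r`; together with `M u ≤
L` it bounds `M^5` by `B L² r`. The product supplies `u² r² = u² N³`, which cancels `u⁻¹` and leaves
`M / N` after the root. This is where the exponent five fits. -/
theorem inv_mul_sqrt_le {u B L M N r : ℝ} (hu : 0 < u) (hB : 0 ≤ B) (hL : 0 ≤ L) (hM : 0 ≤ M)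
    (hN : 0 < N) (hr : 0 < r) (hrN : r ^ 2 = N ^ 3) (h1 : M ^ 3 / (u ^ 2 * r) ≤ B)
    (h2 : M * u ≤ L) : u⁻¹ * √((M ^ 2 / N) ^ 5) ≤ L * B * (M / N) := by
  rw [div_le_iff₀ (by positivity)] at h1
  have hMu : (M * u) ^ 2 ≤ L ^ 2 := by gcongr
  have h5 : M ^ 5 ≤ B * L ^ 2 * r := by
    refine le_of_mul_le_mul_right ?_ (show 0 < u ^ 2 by positivity)
    calc M ^ 5 * u ^ 2 = M ^ 3 * (M * u) ^ 2 := by ring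
      _ ≤ (B * (u ^ 2 * r)) * L ^ 2 := by gcongr
      _ = _ := by ring
  have h8 : M ^ 8 ≤ (L * B * u) ^ 2 * N ^ 3 := by
    calc M ^ 8 = M ^ 3 * M ^ 5 := by ring
      _ ≤ (B * (u ^ 2 * r)) * (B * L ^ 2 * r) := by gcongr
      _ = (L * B * u) ^ 2 * r ^ 2 := by ring
      _ = _ := by rw [hrN]
  rw [inv_mul_le_iff₀ hu]
  refine Real.sqrt_le_iff.2 ⟨by positivity, ?_⟩
  calc (M ^ 2 / N) ^ 5 = M ^ 2 * M ^ 8 / N ^ 5 := by ring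
    _ ≤ M ^ 2 * ((L * B * u) ^ 2 * N ^ 3) / N ^ 5 := by gcongr
    _ = _ := by field_simp

end Consistency

end Auxiliary

/-! ### The consistency theorem -/

theorem corollary1
    (ψ : HilbertBasis ℕ ℝ L2I) (ω b υ : ℕ → ℝ) (hreg : RegularWeights ω b υ)
    (d η σ : ℝ) (hd : 1 ≤ d) (hη : 1 ≤ η) (hσ : 0 < σ)
    (β : L2I) (hβ : β ∈ sobolevClass ψ b)
    -- the population `(Y, X)` with error term `ε`
    {Ω₀ : Type*} [MeasurableSpace Ω₀] (P₀ : Measure Ω₀) [IsProbabilityMeasure P₀]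
    (X : Ω₀ → L2I) (ε Y : Ω₀ → ℝ)
    (hX : RegressorClass ψ 4 η X P₀) (hε : ErrorClass 4 η ε P₀)
    (hmodel : LinearModel β σ X ε Y P₀)
    (hlink : LinkClass ψ υ d (covOp X P₀))
    -- for each `n`, an `n`-sample of `(Y, X)`
    {Ω : ℕ → Type*} [∀ n, MeasurableSpace (Ω n)] (P : ∀ n, Measure (Ω n))
    [∀ n, IsProbabilityMeasure (P n)]
    (Xs : ∀ n, Fin n → Ω n → L2I) (Ys : ∀ n, Fin n → Ω n → ℝ)
    (hsample : ∀ n, IsSample (Ys n) (Xs n) (P n) Y X P₀)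
    -- the dimension parameter
    (m : ℕ → ℕ) (hm : Tendsto m atTop atTop)
    (hm1 : Tendsto (fun n => (m n : ℝ) / n * ⨆ j : Fin (m n), ω j / υ j) atTop (𝓝 0))
    (hm2 : Tendsto (fun n => (m n : ℝ) ^ 2 / n) atTop (𝓝 0))
    (hm3 : (fun n : ℕ => (m n : ℝ) ^ 3 / (υ (m n - 1) ^ 2 * (n : ℝ) ^ (1 + 1 / 2 : ℝ)))
      =O[atTop] (fun _ => (1 : ℝ))) :
    Tendsto
      (fun n => ∫⁻ w, weightedNormSq ψ ω
        (estimator ψ (m n) (8 * d ^ 3 / υ (m n - 1)) (fun i => Ys n i w) (fun i => Xs n i w) - β)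
        ∂(P n))
      atTop (𝓝 0) := by
  have hυ := hreg.upsilon_summable
  have hυ0 := hreg.upsilon_pos
  have hL : 0 ≤ ∑' j, υ j := tsum_nonneg fun j => (hυ0 j).le
  have hη0 : 0 < η := by linarith
  set L : ℝ := ∑' j, υ j with hLdef
  set K : ℝ := 1 + (d ^ 2 * (1 + d ^ 2)) ^ 2 with hK
  obtain ⟨hX4, hX4'⟩ := integral_norm_pow_four_le hυ hυ0 hd hη hX hlink
  -- A bound on the fourth moment of the residual that is independent of `n`, because the Galerkin
  -- bias bound with unit weights is uniform in the dimension.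
  set C : ℝ := 8 * ((K * (2 * ‖β‖) ^ 2) ^ 2 * (η * d ^ 2 * L ^ 2) + σ ^ 4 * η) with hC
  have hC0 : 0 ≤ C := by positivity
  have hβω := hreg.weightedNormSq_ne_top hβ
  obtain ⟨B, hB0, hB⟩ := hm3.exists_pos
  rw [IsBigOWith] at hB
  set s : ℕ → ℝ := fun n => ⨆ j : Fin (m n), ω j / υ j with hs
  have hs0 (n : ℕ) : 0 ≤ s n :=
    Real.iSup_nonneg fun j => (div_pos (hreg.omega_pos j) (hυ0 j)).le
  have hωs (n : ℕ) : ∀ j < m n, ω j ≤ s n * υ j := fun j hj => by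
    rw [← div_le_iff₀ (hυ0 j)]
    exact le_ciSup (f := fun j : Fin (m n) => ω j / υ j) (Set.finite_range _).bddAbove ⟨j, hj⟩
  set D : ℝ := √((40 * η) ^ 5) * (L * B) with hD
  have hD0 : 0 ≤ D := by positivity
  have hbound : ∀ᶠ n in atTop, ∫⁻ w, weightedNormSq ψ ω
      (estimator ψ (m n) (8 * d ^ 3 / υ (m n - 1)) (fun i => Ys n i w) (fun i => Xs n i w) - β)
        ∂(P n)
      ≤ 2 * (ENNReal.ofReal K * weightedNormSq ψ ω (β - basisProj ψ (m n) β))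
        + weightedNormSq ψ ω β * ENNReal.ofReal (4 * η * ((m n : ℝ) ^ 2 / n))
        + 2 * ENNReal.ofReal (200 * d * (C + η) * ((m n : ℝ) / n * s n))
        + 2 * ENNReal.ofReal (4 * d ^ 5 * (C + 1) * D * ((m n : ℝ) / n * s n)) := by
    filter_upwards [hB, hm.eventually_ge_atTop 1, eventually_ge_atTop 5] with n hBn hmn hn
    have hn0 : (0 : ℝ) < n := by exact_mod_cast (by omega : 0 < n)
    have hk0 : (0 : ℝ) < (n / 5 : ℕ) := by exact_mod_cast (by omega : 0 < n / 5)
    have hυm := hυ0 (m n - 1)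
    set f := galerkinCoeffs ψ (m n) (covOp X P₀) β with hf
    have hf0 : ∀ i < m n, ⟪covOp X P₀ (β - synth ψ f), ψ i⟫ = 0 := fun i hi => by
      rw [real_inner_comm, map_sub, inner_sub_right, inner_basis_apply_galerkin
        (posDef_opMatrix hlink.inner_comm hX.strictPos) i hi, sub_self]
    have hnorm := norm_sub_galerkin_sq_le (β := β) hlink hυ hυ0 hreg.upsilon_anti hd hX.strictPos hmn
    obtain ⟨h4, h4'⟩ := integral_residual_pow_four_le hX.memLp hX4 hX4' hε hmodel (synth ψ f)
    have h4C : ∫ w, regResidual (synth ψ f) (Y w, X w) ^ 4 ∂P₀ ≤ C := by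
      refine h4'.trans ?_
      rw [hC, show ‖β - synth ψ f‖ ^ 4 = (‖β - synth ψ f‖ ^ 2) ^ 2 by ring]
      gcongr
    refine (lintegral_estimator_sub_le hreg hlink hd hη hn hmn hC0 hX hε.memLp hmodel (hsample n)
      hf0 h4 h4C (hs0 n) (hωs n)).trans ?_
    -- The bad-block term thus gets the same rate `m / n · sup (ω / υ)` as the score term. The `40`
    -- is `4` times the `10` lost in the block size.
    have hsqrt : (υ (m n - 1))⁻¹ * √((4 * (m n : ℝ) ^ 2 * η / (n / 5 : ℕ)) ^ 5)
        ≤ D * ((m n : ℝ) / n) := by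
      have h10 : (n : ℝ) ≤ 10 * ((n / 5 : ℕ) : ℝ) := by
        exact_mod_cast (by omega : n ≤ 10 * (n / 5))
      have e1 : 4 * (m n : ℝ) ^ 2 * η / (n / 5 : ℕ) ≤ 40 * η * ((m n : ℝ) ^ 2 / n) := by
        rw [← mul_div_assoc, div_le_div_iff₀ hk0 hn0]
        calc 4 * (m n : ℝ) ^ 2 * η * n ≤ 4 * (m n : ℝ) ^ 2 * η * (10 * ((n / 5 : ℕ) : ℝ)) := by
              gcongr
          _ = _ := by ring
      have e2 : √((4 * (m n : ℝ) ^ 2 * η / (n / 5 : ℕ)) ^ 5)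
          ≤ √((40 * η) ^ 5) * √(((m n : ℝ) ^ 2 / n) ^ 5) := by
        rw [← Real.sqrt_mul (by positivity), ← mul_pow]
        gcongr
      have e3 : ((n : ℝ) ^ (1 + 1 / 2 : ℝ)) ^ 2 = (n : ℝ) ^ 3 := by
        rw [← Real.rpow_natCast, ← Real.rpow_mul hn0.le, ← Real.rpow_natCast]
        norm_num
      have e4 := inv_mul_sqrt_le (u := υ (m n - 1)) (B := B) (L := L) (M := m n) (N := n)
        (r := (n : ℝ) ^ (1 + 1 / 2 : ℝ)) hυm hB0.le hL (by positivity) hn0 (by positivity) e3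
        (by simpa using (le_abs_self _).trans hBn)
        (mul_le_tsum_of_antitone hυ hυ0 hreg.upsilon_anti hmn)
      calc _ ≤ (υ (m n - 1))⁻¹ * (√((40 * η) ^ 5) * √(((m n : ℝ) ^ 2 / n) ^ 5)) := by gcongr
        _ = √((40 * η) ^ 5) * ((υ (m n - 1))⁻¹ * √(((m n : ℝ) ^ 2 / n) ^ 5)) := by ring
        _ ≤ √((40 * η) ^ 5) * (L * B * ((m n : ℝ) / n)) := by gcongr
        _ = _ := by rw [hD]; ring
    have hsn := hs0 n
    gcongr ?_ + ?_ + ?_ + ?_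
    · gcongr
      exact weightedNormSq_galerkin_bias_le hlink hυ hυ0 hreg.upsilon_anti hd hX.strictPos
        hreg.omega_pos hreg.upsilon_sq_div_omega_anti hmn
    · refine le_of_eq ?_
      congr 2
      ring
    · exact le_rfl
    · gcongr 2 * ENNReal.ofReal ?_
      calc _ ≤ 4 * d ^ 5 * (C + 1) * (s n * (D * ((m n : ℝ) / n))) := by gcongr
        _ = _ := by ring
  refine tendsto_of_tendsto_of_tendsto_of_le_of_le' tendsto_const_nhds ?_
    (Eventually.of_forall fun n => zero_le) hbound
  have t1 : Tendsto (fun n => 2 * (ENNReal.ofReal K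
      * weightedNormSq ψ ω (β - basisProj ψ (m n) β))) atTop (𝓝 0) := by
    have h := (tendsto_weightedNormSq_sub_basisProj hβω).comp hm
    have := ENNReal.Tendsto.const_mul (a := 2)
      (ENNReal.Tendsto.const_mul (a := ENNReal.ofReal K) h (Or.inr ENNReal.ofReal_ne_top))
      (Or.inr ENNReal.ofNat_ne_top)
    simpa using this
  have tof (c : ℝ) {g : ℕ → ℝ} (hg : Tendsto g atTop (𝓝 0)) :
      Tendsto (fun n => ENNReal.ofReal (c * g n)) atTop (𝓝 0) := by
    simpa using ENNReal.tendsto_ofReal (hg.const_mul c)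
  have t2 := ENNReal.Tendsto.const_mul (a := weightedNormSq ψ ω β) (tof (4 * η) hm2) (Or.inr hβω)
  have t3 (c : ℝ) := ENNReal.Tendsto.const_mul (a := 2) (tof c hm1) (Or.inr ENNReal.ofNat_ne_top)
  rw [mul_zero] at t2
  simp only [mul_zero] at t3
  simpa using ((t1.add t2).add (t3 (200 * d * (C + η)))).add (t3 (4 * d ^ 5 * (C + 1) * D))
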